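/- \textbf{Setting.} All topoi are Grothendieck topoi over $\mathcal{S}=\mathrm{Sets}$, with structure morphism $\gamma$ (so $\gamma^*T=\coprod_{T}1$). A geometric morphism $f$ is \emph{connected} if $f^*$ is full and faithful, \emph{locally connected} if $f^*$ has a left adjoint $f_!$ that is indexed over the codomain, \emph{atomic} if $f^*$ is logical, and \emph{surjective} if $f^*$ is faithful. A topos is connected, locally connected or atomic if its structure morphism is, and boolean if every subobject is complemented. Let $\mathcal{E}$ be a topos and $\mathcal{U}=\{U_i\}_{i\in I}$ a cover of $\mathcal{E}$, that is, a small family of objects $U_i\neq\emptyset$ such that $\{U_i\to 1\}_{i\in I}$ is an epimorphic family. Let $\mathcal{P}_\mathcal{U}$ be the category of locally constant objects split by $\mathcal{U}$. Its objects are triples $X=(X,\,S\to I,\,\theta)$, where $X\in\mathcal{E}$, $S\to I$ is a family of sets $\{S_i\}_{i\in I}$, and $\theta$ is a family of isomorphisms $\theta_i:\gamma^*S_i\times U_i\to X\times U_i$ over $U_i$. Its arrows $(X,S,\theta)\to(Y,T,\theta')$ are pairs consisting of $f:X\to Y$ and functions $\vartheta_i:S_i\to T_i$ with $(f\times U_i)\,\theta_i=\theta'_i\,(\gamma^*\vartheta_i\times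 U_i)$ for all $i$. The descent datum of such an object is the family of isomorphisms $$\sigma_{j,i}=(\theta_j^{-1}\times U_i)\circ(X\times\tau)\circ(\theta_i\times U_j):\ \gamma^*S_i\times U_i\times U_j\to\gamma^*S_j\times U_j\times U_i ,$$ where $\tau:U_i\times U_j\to U_j\times U_i$ is the symmetry. An \emph{action triple} for $X$ (from $i$ to $j$) is a triple $(u,v,s)$ with $u:C\to U_i$, $v:C\to U_j$, $C\in\mathcal{E}$, $C\neq\emptyset$, and $s:S_i\to S_j$ a bijection, such that $\sigma_{j,i}\circ(\gamma^*S_i\times(u,v))=(\gamma^*S_j\times(v,u))\circ(\gamma^*s\times C)$. The object $X$ is a \emph{covering projection} if for all $i,j$ with $U_i\times U_j\neq\emptyset$ the arrows $(u,v):C\to U_i\times U_j$, for $(u,v,s)$ ranging over all action triples from $i$ to $j$, form an epimorphic family. Let $\mathcal{G}_\mathcal{U}\subset\mathcal{P}_\mathcal{U}$ be the full subcategory of the objects that are sums (small coproducts in $\mathcal{P}_\mathcal{U}$) of covering projections. \textbf{Theorem.} $\mathcal{P}_\mathcal{U}$ is a topos, and: 1. The category $\mathcal{G}_\mathcal{U}$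 is an atomic (locally connected and boolean) topos, and the full inclusion $\mathcal{G}_\mathcal{U}\subset\mathcal{P}_\mathcal{U}$ is the inverse image of a geometric morphism $\mathcal{P}_\mathcal{U}\to\mathcal{G}_\mathcal{U}$. If $\mathcal{E}$ is connected, so is $\mathcal{G}_\mathcal{U}$. 2. The functor $\varrho^*:\mathcal{G}_\mathcal{U}\to\mathcal{S}_{/I}$, $\varrho^*(X,S\to I,\theta)=(S\to I)$, is the inverse image of a surjective point $\varrho:\mathcal{S}_{/I}\to\mathcal{G}_\mathcal{U}$. -/

import Mathlib

open CategoryTheory CategoryTheory.Limits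

universe u v w

noncomputable section

/-! ### Grothendieck topoi and geometric morphisms -/

/-- A Grothendieck topos (over `Type u`): a category equivalent to the category of sheaves of
sets on a small site. -/
class IsGrothendieckTopos (T : Type v) [Category.{u} T] : Prop where
  exists_site : ∃ (C : Type u) (_ : SmallCategory C) (J : GrothendieckTopology C),
    Nonempty (T ≌ Sheaf J (Type u))

namespace IsGrothendieckTopos

variable (T : Type v) [Category.{u} T] [IsGrothendieckTopos.{u} T]

instance hasLimits : HasLimitsOfSize.{u, u} T := by
  obtain ⟨C, _, J, ⟨e⟩⟩ := IsGrothendieckTopos.exists_site (T := T)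
  exact Adjunction.has_limits_of_equivalence e.functor

instance hasColimits : HasColimitsOfSize.{u, u} T := by
  obtain ⟨C, _, J, ⟨e⟩⟩ := IsGrothendieckTopos.exists_site (T := T)
  have : HasSheafify J (Type u) := inferInstance
  have : HasColimitsOfSize.{u, u} (Sheaf J (Type u)) := CategoryTheory.Sheaf.instHasColimitsOfSize
  exact Adjunction.has_colimits_of_equivalence e.functor

instance hasFiniteLimits : HasFiniteLimits T := hasFiniteLimits_of_hasLimits T

end IsGrothendieckTopos

/-- A geometric morphism `F ⟶ E`: an adjunction `f^* ⊣ f_*` with `f^* : E ⥤ F` preserving finite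
limits. -/
structure GeometricMorphism (F : Type v) [Category.{u} F] (E : Type w) [Category.{u} E] where
  inverseImage : E ⥤ F
  directImage : F ⥤ E
  adj : inverseImage ⊣ directImage
  preservesFiniteLimits : PreservesFiniteLimits inverseImage

/-- Two arrows `r : R ⟶ A`, `s : R ⟶ B` are jointly monic, i.e. they exhibit `R` as a subobject of
`A × B` (a relation from `A` to `B`). -/
def IsRelation {T : Type v} [Category.{u} T] {R A B : T} (r : R ⟶ A) (s : R ⟶ B) : Prop :=
  ∀ ⦃Z : T⦄ (f g : Z ⟶ R), f ≫ r = g ≫ r → f ≫ s = g ≫ s → f = g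

/-- `(a, p) : M ⟶ A × P` exhibits `P` as a power object of `A`, with membership relation `M`: every
relation `R` from `A` to `B` is the pullback of `M` along `A × χ` for a unique `χ : B ⟶ P`.
(The pullback of `M` along `A × χ : A × B ⟶ A × P` is `M ×_P B`, with its arrows to `A`
and `B`.) -/
structure IsPowerObject {T : Type v} [Category.{u} T] {M A P : T} (a : M ⟶ A) (p : M ⟶ P) :
    Prop where
  isRelation : IsRelation a p
  existsUnique_classifying : ∀ ⦃R B : T⦄ (r : R ⟶ A) (s : R ⟶ B), IsRelation r s →
    ∃! χ : B ⟶ P, ∃ t : R ⟶ M, t ≫ a = r ∧ IsPullback t s p χ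

/-- A logical functor: it preserves finite limits and power objects. -/
structure IsLogical {S : Type w} [Category.{u} S] {T : Type v} [Category.{u} T] (F : S ⥤ T) :
    Prop where
  preservesFiniteLimits : PreservesFiniteLimits F
  map_powerObject : ∀ ⦃M A P : S⦄ (a : M ⟶ A) (p : M ⟶ P), IsPowerObject a p →
    IsPowerObject (F.map a) (F.map p)

namespace GeometricMorphism

variable {F : Type v} [Category.{u} F] {E : Type w} [Category.{u} E] (f : GeometricMorphism F E)

/-- `f` is connected: `f^*` is full and faithful. -/
def IsConnected : Prop := f.inverseImage.Full ∧ f.inverseImage.Faithful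

/-- `f` is a surjection: `f^*` is faithful. -/
def IsSurjective : Prop := f.inverseImage.Faithful

/-- `f` is atomic: `f^*` is logical. -/
def IsAtomic : Prop := IsLogical f.inverseImage

/-- `f : F ⟶ E` is locally connected: `f^*` has a left adjoint `f_!` which is `E`-indexed.
The latter means that the functors `f_! : F / f^* B ⥤ E / B`, sending `x : X ⟶ f^* B` to its
transpose `f_! X ⟶ B`, commute with pulling back along the arrows `h : A ⟶ B` of `E`. -/
def IsLocallyConnected : Prop :=
  ∃ (L : F ⥤ E) (adj : L ⊣ f.inverseImage),
    ∀ ⦃A B : E⦄ (h : A ⟶ B) ⦃X Y : F⦄ (x : X ⟶ f.inverseImage.obj B)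
      (k : Y ⟶ X) (y : Y ⟶ f.inverseImage.obj A),
      IsPullback k y x (f.inverseImage.map h) →
        IsPullback (L.map k) ((adj.homEquiv Y A).symm y) ((adj.homEquiv X B).symm x) h

end GeometricMorphism

section StructureMorphism

variable (T : Type v) [Category.{u} T] [IsGrothendieckTopos.{u} T]

/-- The constant object functor `γ^* : Type u ⥤ T`, sending `S` to the sum of `S` copies of the
terminal object. -/
def constInv : Type u ⥤ T := sigmaConst.obj (⊤_ T)

/-- `γ^*` is left adjoint to the global sections functor `γ_* = Hom(1, -)`. -/
def constInvAdj : constInv T ⊣ coyoneda.obj (Opposite.op (⊤_ T)) := sigmaConstAdj (⊤_ T)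

theorem constInv_preservesFiniteLimits : PreservesFiniteLimits (constInv T) := by
  obtain ⟨C, _, J, ⟨e⟩⟩ := IsGrothendieckTopos.exists_site (T := T)
  let L : Type u ⥤ T := constantSheaf J (Type u) ⋙ e.inverse
  let R : T ⥤ Type u := e.functor ⋙ Sheaf.Γ J (Type u)
  let adj : L ⊣ R := (constantSheafΓAdj J (Type u)).comp e.symm.toAdjunction
  have h₁ : PreservesFiniteLimits (Functor.const Cᵒᵖ : Type u ⥤ _) :=
    ⟨fun _ _ _ => inferInstance⟩
  have h₂ : PreservesFiniteLimits (constantSheaf J (Type u)) :=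
    comp_preservesFiniteLimits (Functor.const Cᵒᵖ) (presheafToSheaf J (Type u))
  have h₃ : PreservesFiniteLimits L := comp_preservesFiniteLimits _ _
  let a : L.obj PUnit.{u + 1} ≅ ⊤_ T :=
    (IsTerminal.isTerminalObj L _ Types.isTerminalPUnit).uniqueUpToIso terminalIsTerminal
  let b : R ≅ coyoneda.obj (Opposite.op (⊤_ T)) :=
    NatIso.ofComponents (fun X =>
      { hom := ↾fun x => a.inv ≫ (adj.homEquiv PUnit.{u + 1} X).symm (↾fun _ => x)
        inv := ↾fun g => (adj.homEquiv PUnit.{u + 1} X (a.hom ≫ g)) PUnit.unit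
        hom_inv_id := by
          ext x
          simp
        inv_hom_id := by
          ext g
          have : (↾fun _ => (adj.homEquiv PUnit.{u + 1} X (a.hom ≫ g)) PUnit.unit) =
            adj.homEquiv PUnit.{u + 1} X (a.hom ≫ g) := by ext; rfl
          simp [this] })
      (fun {X Y} g => by
        ext x
        have : (↾fun _ : PUnit.{u + 1} => R.map g x) = (↾fun _ => x) ≫ R.map g := by ext; rfl
        simp [this, Adjunction.homEquiv_naturality_right_symm])
  exact preservesFiniteLimits_of_natIso
    ((adj.ofNatIsoRight b).leftAdjointUniq (constInvAdj T))

/-- The structure morphism `γ : T ⟶ Sets` of a Grothendieck topos. -/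
def structureMorphism : GeometricMorphism T (Type u) where
  inverseImage := constInv T
  directImage := coyoneda.obj (Opposite.op (⊤_ T))
  adj := constInvAdj T
  preservesFiniteLimits := constInv_preservesFiniteLimits T

/-- A topos is connected when its structure morphism is. -/
def IsConnectedTopos : Prop := (structureMorphism T).IsConnected

/-- A topos is locally connected when its structure morphism is. -/
def IsLocallyConnectedTopos : Prop := (structureMorphism T).IsLocallyConnected

/-- A topos is atomic when its structure morphism is. -/
def IsAtomicTopos : Prop := (structureMorphism T).IsAtomic

end StructureMorphism

/-- A topos is boolean when each subobject `m : Y ⟶ X` is complemented: there is a subobject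
`n : Z ⟶ X` such that `m` and `n` exhibit `X` as the sum of `Y` and `Z`. -/
def IsBooleanTopos (T : Type v) [Category.{u} T] : Prop :=
  ∀ ⦃X Y : T⦄ (m : Y ⟶ X), Mono m →
    ∃ (Z : T) (n : Z ⟶ X), Mono n ∧ Nonempty (IsColimit (BinaryCofan.mk m n))

/-! ### Covers and locally constant objects -/

/-- A family of arrows with common codomain is epimorphic. -/
def IsEpimorphicFamily {T : Type v} [Category.{u} T] {X : T} {ι : Type w} (C : ι → T)
    (c : ∀ k, C k ⟶ X) : Prop :=
  ∀ ⦃Z : T⦄ (g h : X ⟶ Z), (∀ k, c k ≫ g = c k ≫ h) → g = h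

/-- An object is nonempty when it is not initial. -/
def IsNonemptyObject {T : Type v} [Category.{u} T] (X : T) : Prop := IsEmpty (IsInitial X)

/-- A cover of a topos: a small family of nonempty objects `U i` such that the arrows
`U i ⟶ 1` form an epimorphic family. -/
structure Cover (E : Type v) [Category.{u} E] [IsGrothendieckTopos.{u} E] where
  I : Type u
  U : I → E
  epi : IsEpimorphicFamily U (fun i => terminal.from (U i))
  nonempty : ∀ i, IsNonemptyObject (U i)

variable {E : Type v} [Category.{u} E] [IsGrothendieckTopos.{u} E]

/-- The objects of `P_U`: an object `X` of the topos, a family of sets `S i` (that is, a set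
`S ⟶ I` over `I`), and a trivialization, i.e. isomorphisms
`θ i : γ^* (S i) × U i ≅ X × U i` over `U i`. -/
structure LocConst (𝒰 : Cover.{u} E) where
  X : E
  S : 𝒰.I → Type u
  θ : ∀ i, (constInv E).obj (S i) ⨯ 𝒰.U i ≅ X ⨯ 𝒰.U i
  θ_over : ∀ i, (θ i).hom ≫ prod.snd = prod.snd

namespace LocConst

variable {𝒰 : Cover.{u} E}

/-- The arrows of `P_U`: an arrow `f : X ⟶ Y` together with a family of functions
`ϑ i : S i ⟶ T i`, compatible with the trivializations. -/
@[ext]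
structure Hom (A B : LocConst 𝒰) where
  f : A.X ⟶ B.X
  ϑ : ∀ i, A.S i ⟶ B.S i
  comm : ∀ i, (A.θ i).hom ≫ prod.map f (𝟙 (𝒰.U i)) =
    prod.map ((constInv E).map (ϑ i)) (𝟙 (𝒰.U i)) ≫ (B.θ i).hom

/-- The category `P_U` of locally constant objects split by the cover. -/
instance : Category.{u} (LocConst 𝒰) where
  Hom := Hom
  id A := { f := 𝟙 _, ϑ := fun _ => 𝟙 _, comm := fun i => by simp }
  comp {A B C} g h :=
    { f := g.f ≫ h.f
      ϑ := fun i => g.ϑ i ≫ h.ϑ i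
      comm := fun i => by
        have e₁ : prod.map (g.f ≫ h.f) (𝟙 (𝒰.U i)) =
            prod.map g.f (𝟙 (𝒰.U i)) ≫ prod.map h.f (𝟙 (𝒰.U i)) := by simp
        have e₂ : prod.map ((constInv E).map (g.ϑ i ≫ h.ϑ i)) (𝟙 (𝒰.U i)) =
            prod.map ((constInv E).map (g.ϑ i)) (𝟙 (𝒰.U i)) ≫
              prod.map ((constInv E).map (h.ϑ i)) (𝟙 (𝒰.U i)) := by simp
        rw [e₁, e₂, ← Category.assoc, g.comm, Category.assoc, h.comm, Category.assoc] }
  id_comp _ := by apply Hom.ext <;> simp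
  comp_id _ := by apply Hom.ext <;> simp
  assoc _ _ _ := by apply Hom.ext <;> simp

/-- The functor `ϱ^*` from `P_U` to sets over `I` which forgets the object and its trivialization
(equivalently, the descent datum): `(X, S ⟶ I, θ) ↦ (S ⟶ I)`, where `S` is the disjoint union of
the `S i`. -/
def toFamily (𝒰 : Cover.{u} E) : LocConst 𝒰 ⥤ Over 𝒰.I where
  obj A := Over.mk (Y := Σ i, A.S i) (↾Sigma.fst)
  map g := Over.homMk (↾fun x => ⟨x.1, g.ϑ x.1 x.2⟩)

variable (A : LocConst 𝒰)

/-- The descent datum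
`σ i j : γ^* (S i) × U i × U j ⟶ γ^* (S j) × U j × U i` (written `σ_{j,i}`) of a locally
constant object: the composite
`γ^* (S i) × U i × U j ⟶ X × U i × U j ⟶ X × U j × U i ⟶ γ^* (S j) × U j × U i`
of `θ i × U j`, of the symmetry and of `(θ j)⁻¹ × U i`. -/
def σ (i j : 𝒰.I) : ((constInv E).obj (A.S i) ⨯ 𝒰.U i) ⨯ 𝒰.U j ⟶
    ((constInv E).obj (A.S j) ⨯ 𝒰.U j) ⨯ 𝒰.U i :=
  prod.map (A.θ i).hom (𝟙 (𝒰.U j)) ≫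
    prod.lift (prod.map prod.fst (𝟙 (𝒰.U j))) (prod.fst ≫ prod.snd) ≫
      prod.map (A.θ j).inv (𝟙 (𝒰.U i))

/-- The triple `(u, v, s)`, with `u : C ⟶ U i`, `v : C ⟶ U j`, `C` nonempty and `s` a bijection
`S i ≃ S j`, is an action triple for `A`:
`(γ^* (S i) × (u, v)) ≫ σ i j = (γ^* s × C) ≫ (γ^* (S j) × (v, u))`. -/
structure IsActionTriple {i j : 𝒰.I} {C : E} (u : C ⟶ 𝒰.U i) (v : C ⟶ 𝒰.U j)
    (s : A.S i ≃ A.S j) : Prop where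
  nonempty : IsNonemptyObject C
  comm : prod.lift (prod.map (𝟙 ((constInv E).obj (A.S i))) u) (prod.snd ≫ v) ≫ A.σ i j =
    prod.map ((constInv E).map (↾s)) (𝟙 C) ≫
      prod.lift (prod.map (𝟙 ((constInv E).obj (A.S j))) v) (prod.snd ≫ u)

/-- The index type of all the action triples between `S i` and `S j`. -/
structure ActionTriple (i j : 𝒰.I) where
  C : E
  u : C ⟶ 𝒰.U i
  v : C ⟶ 𝒰.U j
  s : A.S i ≃ A.S j
  isActionTriple : A.IsActionTriple u v s

/-- A locally constant object is a covering projection when, for all `i`, `j` with `U i × U j`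
nonempty, the arrows `(u, v) : C ⟶ U i × U j`, for `(u, v, s)` ranging over all the action triples,
form an epimorphic family. -/
def IsCoveringProjection : Prop :=
  ∀ i j : 𝒰.I, IsNonemptyObject (𝒰.U i ⨯ 𝒰.U j) →
    IsEpimorphicFamily (fun t : A.ActionTriple i j => t.C) (fun t => prod.lift t.u t.v)

end LocConst

/-- The objects of `P_U` which are sums (small coproducts in `P_U`) of covering projections. -/
def isSumOfCoveringProjections (𝒰 : Cover.{u} E) : ObjectProperty (LocConst 𝒰) := fun A =>
  ∃ (K : Type u) (B : K → LocConst 𝒰) (b : ∀ k, B k ⟶ A),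
    (∀ k, (B k).IsCoveringProjection) ∧ Nonempty (IsColimit (Cofan.mk A b))

/-- The full subcategory `G_U` of `P_U` on the sums of covering projections. -/
abbrev CoveringTopos (𝒰 : Cover.{u} E) := (isSumOfCoveringProjections 𝒰).FullSubcategory

/-- The inclusion of `G_U` in `P_U`. -/
abbrev CoveringTopos.incl (𝒰 : Cover.{u} E) : CoveringTopos 𝒰 ⥤ LocConst 𝒰 :=
  (isSumOfCoveringProjections 𝒰).ι

end

noncomputable section

/-! ### The topology of epimorphic families on a topos -/

section EpiTopology

variable {E : Type v} [Category.{u} E]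

/-- A sieve is epimorphic when its arrows are jointly epimorphic. -/
def CategoryTheory.Sieve.IsEpic {X : E} (S : Sieve X) : Prop :=
  ∀ ⦃Z : E⦄ (g h : X ⟶ Z), (∀ ⦃D : E⦄ (d : D ⟶ X), S d → d ≫ g = d ≫ h) → g = h

section Site

variable {C : Type u} [SmallCategory C] {J : GrothendieckTopology C} (e : E ≌ Sheaf J (Type u))

/-- The generators of a topos given by a site of definition. -/
def siteGenerators : C ⥤ E := yoneda ⋙ presheafToSheaf J (Type u) ⋙ e.inverse

/-- Arrows out of the generators are sections of the corresponding sheaf. -/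
def siteSectionsEquiv (c : C) (X : E) :
    ((siteGenerators e).obj c ⟶ X) ≃ (e.functor.obj X).obj.obj (.op c) :=
  ((e.symm.toAdjunction.homEquiv _ X).trans
    ((sheafificationAdjunction J (Type u)).homEquiv _ _)).trans yonedaEquiv

/-- The restricted Yoneda functor of the generators. -/
def siteSections : E ⥤ (Cᵒᵖ ⥤ Type u) :=
  yoneda ⋙ (Functor.whiskeringLeft _ _ _).obj (siteGenerators e).op

lemma siteSectionsEquiv_naturality_left {c d : C} (h : d ⟶ c) {X : E}
    (x : (siteGenerators e).obj c ⟶ X) :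
    siteSectionsEquiv e d X ((siteGenerators e).map h ≫ x) =
      (e.functor.obj X).obj.map h.op (siteSectionsEquiv e c X x) := by
  have h₁ := Adjunction.homEquiv_naturality_left e.symm.toAdjunction
    ((presheafToSheaf J (Type u)).map (yoneda.map h)) x
  have h₂ := Adjunction.homEquiv_naturality_left (sheafificationAdjunction J (Type u))
    (yoneda.map h) (e.symm.toAdjunction.homEquiv _ X x)
  exact (congrArg yonedaEquiv ((congrArg _ h₁).trans h₂)).trans (yonedaEquiv_naturality _ _).symm

lemma siteSectionsEquiv_naturality_right (c : C) {X Y : E}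
    (x : (siteGenerators e).obj c ⟶ X) (f : X ⟶ Y) :
    siteSectionsEquiv e c Y (x ≫ f) =
      (e.functor.map f).hom.app _ (siteSectionsEquiv e c X x) := by
  have h₁ := Adjunction.homEquiv_naturality_right e.symm.toAdjunction x f
  have h₂ := Adjunction.homEquiv_naturality_right (sheafificationAdjunction J (Type u))
    (e.symm.toAdjunction.homEquiv _ X x) (e.functor.map f)
  exact (congrArg yonedaEquiv ((congrArg _ h₁).trans h₂)).trans (yonedaEquiv_comp _ _)

/-- The restricted Yoneda functor is the given equivalence with sheaves. -/
def siteSectionsIso : siteSections e ≅ e.functor ⋙ sheafToPresheaf J (Type u) :=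
  NatIso.ofComponents (fun X => NatIso.ofComponents
    (fun c => (siteSectionsEquiv e c.unop X).toIso)
    (fun h => ConcreteCategory.hom_ext _ _ (siteSectionsEquiv_naturality_left e h.unop)))
    (fun f => NatTrans.ext (funext fun c => ConcreteCategory.hom_ext _ _ fun x =>
      siteSectionsEquiv_naturality_right e c.unop x f))

instance : (siteSections e).Full := Functor.Full.of_iso (siteSectionsIso e).symm

instance : (siteSections e).Faithful := Functor.Faithful.of_iso (siteSectionsIso e).symm

lemma siteSections_isSheaf (X : E) : Presieve.IsSheaf J ((siteSections e).obj X) :=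
  Presieve.isSheaf_iso J ((siteSectionsIso e).app X).symm
    ((isSheaf_iff_isSheaf_of_type _ _).1 (e.functor.obj X).property)

lemma exists_siteSections_iso (P : Cᵒᵖ ⥤ Type u) (hP : Presieve.IsSheaf J P) :
    ∃ X : E, Nonempty ((siteSections e).obj X ≅ P) := by
  let Q : Sheaf J (Type u) := ⟨P, (isSheaf_iff_isSheaf_of_type _ _).2 hP⟩
  exact ⟨e.inverse.obj Q, ⟨(siteSectionsIso e).app _ ≪≫
    (sheafToPresheaf J (Type u)).mapIso (e.counitIso.app Q)⟩⟩

/-- The sieve of all arrows `h` such that `h ≫ x` is in `S`. -/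
def sectionSieve {X : E} (S : Sieve X) {c : C} (x : (siteGenerators e).obj c ⟶ X) : Sieve c where
  arrows _ h := S ((siteGenerators e).map h ≫ x)
  downward_closed hf g := by
    have := S.downward_closed hf ((siteGenerators e).map g)
    rwa [← Category.assoc, ← Functor.map_comp] at this

lemma sectionSieve_pullback {X : E} (S : Sieve X) {c d : C} (h : d ⟶ c)
    (x : (siteGenerators e).obj c ⟶ X) :
    (sectionSieve e S x).pullback h = sectionSieve e S ((siteGenerators e).map h ≫ x) := by
  ext b k
  change S _ ↔ S _
  simp

lemma isEpic_of_sectionSieve_mem {X : E} {S : Sieve X}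
    (hS : ∀ c (x : (siteGenerators e).obj c ⟶ X), sectionSieve e S x ∈ J c) : S.IsEpic := by
  intro Z g h H
  refine (siteSections e).map_injective (NatTrans.ext (funext fun c =>
    ConcreteCategory.hom_ext _ _ fun (x : (siteGenerators e).obj c.unop ⟶ X) => ?_))
  refine ((siteSections_isSheaf e Z) _ (hS _ x)).isSeparatedFor.ext fun d k hk => ?_
  change (siteGenerators e).map k ≫ x ≫ g = (siteGenerators e).map k ≫ x ≫ h
  simpa only [Category.assoc] using H _ hk

lemma sectionSieve_mem_of_isEpic {X : E} {S : Sieve X} (hS : S.IsEpic) (c : C)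
    (x : (siteGenerators e).obj c ⟶ X) : sectionSieve e S x ∈ J c := by
  obtain ⟨Ω, ⟨i⟩⟩ := exists_siteSections_iso e _ (classifier_isSheaf J)
  let α : (siteSections e).obj X ⟶ (Functor.closedSieves J).toFunctor :=
    { app := fun d => ↾fun y => ⟨J.close (sectionSieve e S (c := d.unop) y), J.close_isClosed _⟩
      naturality := by
        intro d d' h
        refine ConcreteCategory.hom_ext _ _
          fun (y : (siteGenerators e).obj d.unop ⟶ X) => Subtype.ext ?_
        change J.close (sectionSieve e S ((siteGenerators e).map h.unop ≫ _)) =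
          (J.close (sectionSieve e S y)).pullback h.unop
        rw [← sectionSieve_pullback, J.pullback_close] }
  let β : (siteSections e).obj X ⟶ (Functor.closedSieves J).toFunctor :=
    { app := fun d => ↾fun y => ⟨(⊤ : Sieve d.unop), fun _ _ _ => trivial⟩
      naturality := by
        intro d d' h
        refine ConcreteCategory.hom_ext _ _ fun y => Subtype.ext ?_
        exact (Sieve.pullback_top (f := h.unop)).symm }
  have key : (siteSections e).preimage (α ≫ i.inv) = (siteSections e).preimage (β ≫ i.inv) := by
    refine hS _ _ fun D d hd => (siteSections e).map_injective ?_
    simp only [Functor.map_comp, Functor.map_preimage]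
    rw [← Category.assoc, ← Category.assoc]
    congr 1
    refine NatTrans.ext (funext fun c' => ConcreteCategory.hom_ext _ _
      fun (y : (siteGenerators e).obj c'.unop ⟶ D) => Subtype.ext ?_)
    change J.close (sectionSieve e S (y ≫ d)) = ⊤
    rw [J.close_eq_top_iff_mem]
    refine J.superset_covering ?_ (J.top_mem _)
    intro d' k _
    change S _
    rw [← Category.assoc]
    exact S.downward_closed hd _
  have key' : α = β := by
    have := congrArg (siteSections e).map key
    simpa using this
  have h : J.close (sectionSieve e S x) = ⊤ := congrArg Subtype.val
    (ConcreteCategory.congr_hom (NatTrans.congr_app key' (.op c)) x)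
  exact (J.close_eq_top_iff_mem _).1 h

include e in
/-- A topos is the category of sheaves for its epimorphic families: compatible families of arrows
can be glued. -/
lemma isSheafFor_yoneda_of_isEpic {X : E} {S : Sieve X} (hS : S.IsEpic) (Y : E) :
    Presieve.IsSheafFor (yoneda.obj Y) S.arrows := by
  rw [← Presieve.isSeparatedFor_and_exists_isAmalgamation_iff_isSheafFor]
  refine ⟨fun x g h hg hh => hS g h fun D d hd => (hg d hd).trans (hh d hd).symm, ?_⟩
  intro x hx
  rw [Presieve.compatible_iff_sieveCompatible] at hx
  have hsh := siteSections_isSheaf e Y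
  have hcov := fun c y => sectionSieve_mem_of_isEpic e hS c y
  let fam : ∀ c (y : (siteGenerators e).obj c ⟶ X),
      Presieve.FamilyOfElements ((siteSections e).obj Y) (sectionSieve e S y).arrows :=
    fun c y d h hh => x _ hh
  have hfam : ∀ c y, (fam c y).Compatible := by
    intro c y
    rw [Presieve.compatible_iff_sieveCompatible]
    intro d d' h k hh
    have := hx _ ((siteGenerators e).map k) hh
    change x _ _ = (siteGenerators e).map k ≫ x _ _
    rw [← show _ = (siteGenerators e).map k ≫ x _ hh from this]
    congr 1
    simp
  let a : ∀ c (y : (siteGenerators e).obj c ⟶ X), (siteGenerators e).obj c ⟶ Y :=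
    fun c y => (hsh _ (hcov c y)).amalgamate _ (hfam c y)
  have ha : ∀ c y d (h : d ⟶ c) z (hz : S z), (siteGenerators e).map h ≫ y = z →
      (siteGenerators e).map h ≫ a c y = x z hz := by
    rintro c y d h _ hz rfl
    exact Presieve.IsSheafFor.valid_glue (hsh _ (hcov c y)) (hfam c y) h hz
  let α : (siteSections e).obj X ⟶ (siteSections e).obj Y :=
    { app := fun c => ↾fun y => a c.unop y
      naturality := by
        intro c d h
        refine ConcreteCategory.hom_ext _ _
          fun (y : (siteGenerators e).obj c.unop ⟶ X) => ?_
        refine ((siteSections_isSheaf e Y) _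
          (hcov d.unop ((siteGenerators e).map h.unop ≫ y))).isSeparatedFor.ext fun b k hk => ?_
        have h₁ := ha _ _ _ k _ hk rfl
        have h₂ := ha c.unop y _ (k ≫ h.unop) _ hk (by simp)
        rw [Functor.map_comp, Category.assoc] at h₂
        exact h₁.trans h₂.symm }
  refine ⟨(siteSections e).preimage α, fun D d hd => ?_⟩
  apply (siteSections e).map_injective
  change (siteSections e).map (d ≫ _) = _
  rw [Functor.map_comp, Functor.map_preimage]
  refine NatTrans.ext (funext fun c => ConcreteCategory.hom_ext _ _
    fun (y : (siteGenerators e).obj c.unop ⟶ D) => ?_)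
  have hy : S (y ≫ d) := S.downward_closed hd _
  have h₁ := ha c.unop (y ≫ d) _ (𝟙 _) _ hy (by simp)
  rw [CategoryTheory.Functor.map_id, Category.id_comp] at h₁
  exact h₁.trans (hx d y hd)

end Site

variable (E) [IsGrothendieckTopos.{u} E]

/-- The topology of epimorphic sieves on a topos. -/
def epicTopology : GrothendieckTopology E where
  sieves X := {S | S.IsEpic}
  top_mem' X Z g h H := by simpa using H (𝟙 X) trivial
  pullback_stable' X Y S f hS := by
    obtain ⟨C, _, J, ⟨e⟩⟩ := IsGrothendieckTopos.exists_site (T := E)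
    refine isEpic_of_sectionSieve_mem e fun c y => ?_
    refine J.superset_covering ?_ (sectionSieve_mem_of_isEpic e hS c (y ≫ f))
    intro d k hk
    change S ((_ ≫ _) ≫ f)
    rw [Category.assoc]
    exact hk
  transitive' X S hS R hR Z g h H := hS g h fun D d hd =>
    hR hd _ _ fun D' d' hd' => by simpa using H _ hd'

variable {E}

lemma isSheafFor_of_mem_epicTopology {X : E} {S : Sieve X} (hS : S ∈ epicTopology E X) (Y : E) :
    Presieve.IsSheafFor (yoneda.obj Y) S.arrows := by
  obtain ⟨C, _, J, ⟨e⟩⟩ := IsGrothendieckTopos.exists_site (T := E)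
  exact isSheafFor_yoneda_of_isEpic e hS Y

lemma ofArrows_mem_epicTopology_iff {X : E} {ι : Type w} (C : ι → E) (c : ∀ k, C k ⟶ X) :
    Sieve.ofArrows C c ∈ epicTopology E X ↔ IsEpimorphicFamily C c := by
  refine ⟨fun h Z g g' H => h g g' ?_, fun h Z g g' H => h g g' fun k => H _ ?_⟩
  · rintro D _ ⟨_, a, _, ⟨k⟩, rfl⟩
    simp [H k]
  · exact Sieve.ofArrows_mk _ _ _

lemma eq_of_mem_epicTopology {X Z : E} {S : Sieve X} (hS : S ∈ epicTopology E X) {g h : X ⟶ Z}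
    (H : ∀ ⦃D : E⦄ (d : D ⟶ X), S d → d ≫ g = d ≫ h) : g = h := hS g h H

variable (E) in
/-- A topos has a small family of generators. -/
lemma exists_small_generators : ∃ (K : Type u) (G : K → E), ∀ X : E,
    Sieve.ofArrows (fun a : Σ k, G k ⟶ X => G a.1) (fun a => a.2) ∈ epicTopology E X := by
  obtain ⟨C, _, J, ⟨e⟩⟩ := IsGrothendieckTopos.exists_site (T := E)
  refine ⟨C, (siteGenerators e).obj, fun X => isEpic_of_sectionSieve_mem e fun c x => ?_⟩
  refine J.superset_covering ?_ (J.top_mem c)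
  intro d h _
  exact ⟨_, 𝟙 _, (siteGenerators e).map h ≫ x,
    Presieve.ofArrows.mk (f := fun a : Σ k, (siteGenerators e).obj k ⟶ X => a.2) ⟨d, _⟩, by simp⟩

/-! ### Empty objects and constant objects -/

/-- An object covered by the empty sieve is initial. -/
lemma nonempty_isInitial_of_bot_mem {X : E} (h : (⊥ : Sieve X) ∈ epicTopology E X) :
    Nonempty (IsInitial X) := by
  have : ∀ Y : E, Nonempty (Unique (X ⟶ Y)) := by
    intro Y
    obtain ⟨g, -, hg⟩ := isSheafFor_of_mem_epicTopology h Y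
      (fun _ _ (h : False) => h.elim) (fun _ _ _ _ _ _ _ (h : False) => h.elim)
    exact ⟨⟨⟨g⟩, fun a => hg a (fun _ _ (h : False) => h.elim)⟩⟩
  have : ∀ Y : E, Unique (X ⟶ Y) := fun Y => (this Y).some
  exact ⟨IsInitial.ofUnique X⟩

lemma mem_epicTopology_of_isInitial {X : E} (hX : IsInitial X) (S : Sieve X) :
    S ∈ epicTopology E X := fun _ _ _ _ => hX.hom_ext _ _

lemma isNonemptyObject_iff {X : E} :
    IsNonemptyObject X ↔ (⊥ : Sieve X) ∉ epicTopology E X := by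
  refine ⟨fun h h' => ?_, fun h => ⟨fun h' => h (mem_epicTopology_of_isInitial h' _)⟩⟩
  exact h.elim (nonempty_isInitial_of_bot_mem h').some

lemma mem_epicTopology_of_not_isNonemptyObject {X : E} (hX : ¬ IsNonemptyObject X) (S : Sieve X) :
    S ∈ epicTopology E X := by
  rw [isNonemptyObject_iff, not_not] at hX
  exact (epicTopology E).superset_covering bot_le hX

/-- The initial object is strict, so arrows to an empty object have an empty domain. -/
lemma IsNonemptyObject.of_hom {X Y : E} (hX : IsNonemptyObject X) (f : X ⟶ Y) :
    IsNonemptyObject Y := by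
  rw [isNonemptyObject_iff] at *
  intro h
  exact hX (by simpa using (epicTopology E).pullback_stable f h)

/-- A covering sieve of a nonempty object contains an arrow with nonempty domain. -/
lemma IsNonemptyObject.exists_of_mem {X : E} (hX : IsNonemptyObject X) {S : Sieve X}
    (hS : S ∈ epicTopology E X) : ∃ (D : E) (d : D ⟶ X), S d ∧ IsNonemptyObject D := by
  by_contra! H
  rw [isNonemptyObject_iff] at hX
  refine hX ((epicTopology E).transitive hS _ fun D d hd => ?_)
  exact mem_epicTopology_of_not_isNonemptyObject (H D d hd) _

/-- To check that a sieve covers, only the nonempty members of a covering sieve matter. -/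
lemma mem_epicTopology_of_le {X : E} {S R : Sieve X} (hS : S ∈ epicTopology E X)
    (h : ∀ ⦃D : E⦄ (d : D ⟶ X), S d → IsNonemptyObject D → R d) : R ∈ epicTopology E X := by
  refine (epicTopology E).transitive hS _ fun D d hd => ?_
  by_cases hD : IsNonemptyObject D
  · rw [Sieve.pullback_eq_top_of_mem _ (h d hd hD)]
    exact (epicTopology E).top_mem D
  · exact mem_epicTopology_of_not_isNonemptyObject hD _

/-- The point of the constant object `γ^* S` given by an element of `S`. -/
def constPt {S : Type u} (s : S) : ⊤_ E ⟶ (constInv E).obj S := Sigma.ι (fun _ : S => ⊤_ E) s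

lemma constPt_map {S T : Type u} (f : S ⟶ T) (s : S) :
    constPt s ≫ (constInv E).map f = constPt (E := E) (f s) := by
  simp [constPt, constInv, sigmaConst]

lemma const_hom_ext {S : Type u} {Y : E} {g h : (constInv E).obj S ⟶ Y}
    (H : ∀ s : S, constPt s ≫ g = constPt s ≫ h) : g = h :=
  Sigma.hom_ext _ _ H

/-- A constant object is covered by its points. -/
lemma constPt_mem (S : Type u) :
    Sieve.ofArrows (fun _ : S => ⊤_ E) (fun s => constPt s) ∈
      epicTopology E ((constInv E).obj S) := by
  rw [ofArrows_mem_epicTopology_iff]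
  exact fun Z g h H => const_hom_ext H

/-- Different points of a constant object are disjoint. -/
lemma constPt_injective {C : E} (hC : IsNonemptyObject C) {S : Type u} {s t : S}
    (h : terminal.from C ≫ constPt s = terminal.from C ≫ constPt t) : s = t := by
  by_contra hst
  have := constInv_preservesFiniteLimits E
  have hp : IsPullback (𝟙 PEmpty.{u + 1} ≫ (↾PEmpty.elim : PEmpty.{u + 1} ⟶ PUnit.{u + 1}))
      (↾PEmpty.elim) (↾fun _ : PUnit => s) (↾fun _ : PUnit => t) := by
    rw [Types.isPullback_iff]
    refine ⟨by ext x; exact x.elim, fun x => x.elim, fun _ _ h => (hst h).elim⟩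
  have hp' := hp.map (constInv E)
  have := (constInvAdj E).leftAdjoint_preservesColimits
  have hinit : IsInitial ((constInv E).obj PEmpty.{u + 1}) :=
    IsInitial.isInitialObj _ _ Types.isInitialPEmpty
  let a : C ⟶ (constInv E).obj PUnit := terminal.from C ≫ constPt PUnit.unit
  have hl : a ≫ (constInv E).map (↾fun _ : PUnit => s) =
      a ≫ (constInv E).map (↾fun _ : PUnit => t) := by
    simp only [a, Category.assoc, constPt_map]
    exact h
  exact (hC.of_hom (hp'.lift _ _ hl)).elim hinit

end EpiTopology
end

noncomputable section
variable {E : Type v} [Category.{u} E] 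

section
open MonoidalCategory

lemma preservesColimits_prod_of_cartesianClosed [HasFiniteProducts E] [CartesianMonoidalCategory E]
    [MonoidalClosed E] (U : E) : PreservesColimitsOfSize.{u, u} (prod.functor.flip.obj U) := by
  have : PreservesColimitsOfSize.{u, u} (tensorLeft U) :=
    (ihom.adjunction U).leftAdjoint_preservesColimits
  let i (X : E) : U ⊗ X ≅ X ⨯ U :=
    { hom := prod.lift (SemiCartesianMonoidalCategory.snd U X)
        (SemiCartesianMonoidalCategory.fst U X)
      inv := CartesianMonoidalCategory.lift prod.snd prod.fst
      hom_inv_id := by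
        apply CartesianMonoidalCategory.hom_ext
        · simpa using prod.lift_snd _ _
        · simpa using prod.lift_fst _ _
      inv_hom_id := by apply Limits.prod.hom_ext <;> simp }
  have hi {X Y : E} (f : X ⟶ Y) : U ◁ f ≫ (i Y).hom = (i X).hom ≫ prod.map f (𝟙 U) := by
    apply Limits.prod.hom_ext <;> simp [i]
  exact preservesColimits_of_natIso (F := tensorLeft U) (NatIso.ofComponents i hi)

lemma preservesColimits_prod_of_equivalence [HasFiniteProducts E] {C : Type u} [SmallCategory C]
    {J : GrothendieckTopology C} (e : E ≌ Sheaf J (Type u)) (U : E) :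
    PreservesColimitsOfSize.{u, u} (prod.functor.flip.obj U) := by
  have h : MonoidalClosed (Sheaf J (Type u)) := inferInstance
  let _ : CartesianMonoidalCategory E := CartesianMonoidalCategory.ofHasFiniteProducts
  let _ : MonoidalClosed E := @cartesianClosedOfEquiv (Sheaf J (Type u)) _ _ E _ _ e.symm h
  exact preservesColimits_prod_of_cartesianClosed U

lemma preservesConnectedLimits_prod [HasFiniteProducts E] (U : E) (J : Type w) [Category J]
    [CategoryTheory.IsConnected J] :
    PreservesLimitsOfShape J (prod.functor.flip.obj U) := by
  have h : PreservesLimitsOfShape J (Over.star U ⋙ Over.forget U) := inferInstance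
  have hi {X Y : E} (f : X ⟶ Y) : prod.map (𝟙 U) f ≫ (prod.braiding U Y).hom =
      (prod.braiding U X).hom ≫ prod.map f (𝟙 U) := by
    apply Limits.prod.hom_ext <;> simp
  exact preservesLimitsOfShape_of_natIso (F := Over.star U ⋙ Over.forget U)
    (NatIso.ofComponents (fun X => prod.braiding U X) hi)
end

variable [IsGrothendieckTopos.{u} E]

/-- In a topos, taking the product with an object preserves colimits. -/
lemma preservesColimits_prod (U : E) :
    PreservesColimitsOfSize.{u, u} (prod.functor.flip.obj U) := by
  obtain ⟨C, _, J, ⟨e⟩⟩ := IsGrothendieckTopos.exists_site (T := E)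
  exact preservesColimits_prod_of_equivalence e U

/-! ### Limits and colimits of locally constant objects -/

namespace LocConst

variable {𝒰 : Cover.{u} E}

@[ext]
lemma hom_ext {A B : LocConst 𝒰} {g h : A ⟶ B} (hf : g.f = h.f) (hϑ : ∀ i, g.ϑ i = h.ϑ i) :
    g = h := Hom.ext hf (funext hϑ)

variable (𝒰) in
/-- The functor sending a locally constant object to its underlying object. -/
@[simps]
def total : LocConst 𝒰 ⥤ E where
  obj A := A.X
  map g := g.f

variable (𝒰) in
/-- The fibre functors on locally constant objects. -/
@[simps]
def fiber (i : 𝒰.I) : LocConst 𝒰 ⥤ Type u where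
  obj A := A.S i
  map g := g.ϑ i

variable (𝒰) in
/-- The trivializations, as natural isomorphisms. -/
def thetaIso (i : 𝒰.I) :
    fiber 𝒰 i ⋙ constInv E ⋙ prod.functor.flip.obj (𝒰.U i) ≅
      total 𝒰 ⋙ prod.functor.flip.obj (𝒰.U i) :=
  NatIso.ofComponents (fun A => A.θ i) (fun g => (g.comm i).symm)

section Compatibility

variable {X Y Z U : E} {P Q R : Type u} {a : (constInv E).obj P ⨯ U ⟶ X ⨯ U}
  {b : (constInv E).obj Q ⨯ U ⟶ Y ⨯ U} {c : (constInv E).obj R ⨯ U ⟶ Z ⨯ U}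
  {f : X ⟶ Y} {g : Y ⟶ Z} {h : X ⟶ Z} {f' : P ⟶ Q} {g' : Q ⟶ R} {h' : P ⟶ R}

lemma comm_comp_of_comm (hf : f ≫ g = h) (hf' : f' ≫ g' = h')
    (hh : a ≫ prod.map h (𝟙 U) = prod.map ((constInv E).map h') (𝟙 U) ≫ c)
    (hg : b ≫ prod.map g (𝟙 U) = prod.map ((constInv E).map g') (𝟙 U) ≫ c) :
    (a ≫ prod.map f (𝟙 U)) ≫ prod.map g (𝟙 U) =
      (prod.map ((constInv E).map f') (𝟙 U) ≫ b) ≫ prod.map g (𝟙 U) := by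
  rw [Category.assoc, Category.assoc, hg, prod.map_map, hf, ← Category.assoc, prod.map_map,
    ← Functor.map_comp, hf', Category.comp_id, hh]

lemma comp_comm_of_comm (hf : f ≫ g = h) (hf' : f' ≫ g' = h')
    (hh : a ≫ prod.map h (𝟙 U) = prod.map ((constInv E).map h') (𝟙 U) ≫ c)
    (hg : a ≫ prod.map f (𝟙 U) = prod.map ((constInv E).map f') (𝟙 U) ≫ b) :
    prod.map ((constInv E).map f') (𝟙 U) ≫ b ≫ prod.map g (𝟙 U) =
      prod.map ((constInv E).map f') (𝟙 U) ≫ prod.map ((constInv E).map g') (𝟙 U) ≫ c := by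
  rw [← Category.assoc, ← hg, Category.assoc, prod.map_map, hf, ← Category.assoc, prod.map_map,
    ← Functor.map_comp, hf', Category.comp_id, hh]

lemma over_of_comp_comm (hb : b ≫ prod.map g (𝟙 U) = prod.map ((constInv E).map g') (𝟙 U) ≫ c)
    (hc : c ≫ prod.snd = prod.snd) : b ≫ prod.snd = prod.snd := by
  have := congrArg (· ≫ prod.snd) hb
  simpa [hc] using this

lemma comp_over_of_comm (hb : prod.map ((constInv E).map f') (𝟙 U) ≫ b = a ≫ prod.map f (𝟙 U))
    (ha : a ≫ prod.snd = prod.snd) :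
    prod.map ((constInv E).map f') (𝟙 U) ≫ b ≫ prod.snd =
      prod.map ((constInv E).map f') (𝟙 U) ≫ prod.snd := by
  rw [← Category.assoc, hb]
  simp [ha]

lemma comp_snd_eq (ha : a ≫ prod.snd = prod.snd) :
    (a ≫ prod.map f (𝟙 U)) ≫ prod.snd =
      (prod.map ((constInv E).map f') (𝟙 U) ≫ 𝟙 _) ≫ prod.snd := by
  simp [ha]

end Compatibility

section

variable {J : Type w} [Category* J] (D : J ⥤ LocConst 𝒰)

section Limits

variable [CategoryTheory.IsConnected J] [HasLimitsOfShape J E] [HasLimitsOfShape J (Type u)]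
  [PreservesLimitsOfShape J (constInv E)]
  [∀ i, PreservesLimitsOfShape J (prod.functor.flip.obj (𝒰.U i))]

/-- The trivialization of a limit of locally constant objects. -/
def limitθ (i : 𝒰.I) :
    (constInv E).obj (limit (D ⋙ fiber 𝒰 i)) ⨯ 𝒰.U i ≅ limit (D ⋙ total 𝒰) ⨯ 𝒰.U i :=
  (isLimitOfPreserves (constInv E ⋙ prod.functor.flip.obj (𝒰.U i))
    (limit.isLimit (D ⋙ fiber 𝒰 i))).conePointsIsoOfNatIso
      (isLimitOfPreserves (prod.functor.flip.obj (𝒰.U i)) (limit.isLimit (D ⋙ total 𝒰)))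
      (Functor.isoWhiskerLeft D (thetaIso 𝒰 i))

lemma limitθ_hom_π (i : 𝒰.I) (j : J) :
    (limitθ D i).hom ≫ prod.map (limit.π (D ⋙ total 𝒰) j) (𝟙 (𝒰.U i)) =
      prod.map ((constInv E).map (limit.π (D ⋙ fiber 𝒰 i) j)) (𝟙 (𝒰.U i)) ≫
        ((D.obj j).θ i).hom :=
  IsLimit.conePointsIsoOfNatIso_hom_comp _ _ _ j

/-- The limit of a connected diagram of locally constant objects. -/
@[simps]
def limitObj : LocConst 𝒰 where
  X := limit (D ⋙ total 𝒰)
  S i := limit (D ⋙ fiber 𝒰 i)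
  θ i := limitθ D i
  θ_over i := by
    have j : J := Classical.arbitrary J
    exact over_of_comp_comm (limitθ_hom_π D i j) ((D.obj j).θ_over i)

/-- The cone of a limit of locally constant objects. -/
@[simps]
def limitCone : Cone D where
  pt := limitObj D
  π :=
    { app := fun j =>
        { f := limit.π (D ⋙ total 𝒰) j
          ϑ := fun i => limit.π (D ⋙ fiber 𝒰 i) j
          comm := fun i => limitθ_hom_π D i j }
      naturality := fun j k h => by
        ext1
        · exact (Category.id_comp _).trans (limit.w (D ⋙ total 𝒰) h).symm
        · exact (Category.id_comp _).trans (limit.w (D ⋙ fiber 𝒰 _) h).symm }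

/-- The universal property of a limit of locally constant objects. -/
def limitConeIsLimit : IsLimit (limitCone D) where
  lift s :=
    { f := limit.lift (D ⋙ total 𝒰) ((total 𝒰).mapCone s)
      ϑ := fun i => limit.lift (D ⋙ fiber 𝒰 i) ((fiber 𝒰 i).mapCone s)
      comm := fun i => by
        refine (isLimitOfPreserves (prod.functor.flip.obj (𝒰.U i))
          (limit.isLimit (D ⋙ total 𝒰))).hom_ext fun j => ?_
        exact comm_comp_of_comm (limit.lift_π _ _) (limit.lift_π _ _) ((s.π.app j).comm i)
          (limitθ_hom_π D i j) }
  fac s j := by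
    ext1
    · exact limit.lift_π _ _
    · exact limit.lift_π _ _
  uniq s m hm := by
    ext1
    · exact (limit.isLimit (D ⋙ total 𝒰)).uniq ((total 𝒰).mapCone s) _
        fun j => congrArg Hom.f (hm j)
    · exact (limit.isLimit (D ⋙ fiber 𝒰 _)).uniq ((fiber 𝒰 _).mapCone s) _
        fun j => congrFun (congrArg Hom.ϑ (hm j)) _

lemma hasLimit_of_isConnected : HasLimit D := ⟨⟨⟨_, limitConeIsLimit D⟩⟩⟩

lemma preservesLimit_fiber (i : 𝒰.I) : PreservesLimit D (fiber 𝒰 i) :=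
  preservesLimit_of_preserves_limit_cone (limitConeIsLimit D)
    (IsLimit.ofIsoLimit (limit.isLimit (D ⋙ fiber 𝒰 i)) (Cone.ext (Iso.refl _) fun _ => (Category.id_comp _).symm))

end Limits

section Colimits

variable [HasColimitsOfShape J E] [HasColimitsOfShape J (Type u)]
  [PreservesColimitsOfShape J (constInv E)]
  [∀ i, PreservesColimitsOfShape J (prod.functor.flip.obj (𝒰.U i))]

/-- The trivialization of a colimit of locally constant objects. -/
def colimitθ (i : 𝒰.I) :
    (constInv E).obj (colimit (D ⋙ fiber 𝒰 i)) ⨯ 𝒰.U i ≅ colimit (D ⋙ total 𝒰) ⨯ 𝒰.U i :=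
  (isColimitOfPreserves (constInv E ⋙ prod.functor.flip.obj (𝒰.U i))
    (colimit.isColimit (D ⋙ fiber 𝒰 i))).coconePointsIsoOfNatIso
      (isColimitOfPreserves (prod.functor.flip.obj (𝒰.U i)) (colimit.isColimit (D ⋙ total 𝒰)))
      (Functor.isoWhiskerLeft D (thetaIso 𝒰 i))

lemma ι_colimitθ_hom (i : 𝒰.I) (j : J) :
    prod.map ((constInv E).map (colimit.ι (D ⋙ fiber 𝒰 i) j)) (𝟙 (𝒰.U i)) ≫
      (colimitθ D i).hom =
    ((D.obj j).θ i).hom ≫ prod.map (colimit.ι (D ⋙ total 𝒰) j) (𝟙 (𝒰.U i)) :=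
  IsColimit.comp_coconePointsIsoOfNatIso_hom
    (isColimitOfPreserves (constInv E ⋙ prod.functor.flip.obj (𝒰.U i))
      (colimit.isColimit (D ⋙ fiber 𝒰 i)))
    (isColimitOfPreserves (prod.functor.flip.obj (𝒰.U i)) (colimit.isColimit (D ⋙ total 𝒰)))
    (Functor.isoWhiskerLeft D (thetaIso 𝒰 i)) j

/-- Arrows out of the domain of the trivialization of a colimit are determined on the
components. -/
lemma colimit_prod_hom_ext {i : 𝒰.I} {Z : E}
    {g h : (constInv E).obj (colimit (D ⋙ fiber 𝒰 i)) ⨯ 𝒰.U i ⟶ Z}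
    (H : ∀ j, prod.map ((constInv E).map (colimit.ι (D ⋙ fiber 𝒰 i) j)) (𝟙 (𝒰.U i)) ≫ g =
      prod.map ((constInv E).map (colimit.ι (D ⋙ fiber 𝒰 i) j)) (𝟙 (𝒰.U i)) ≫ h) : g = h :=
  (isColimitOfPreserves (constInv E ⋙ prod.functor.flip.obj (𝒰.U i))
    (colimit.isColimit (D ⋙ fiber 𝒰 i))).hom_ext H

/-- The colimit of a diagram of locally constant objects. -/
@[simps]
def colimitObj : LocConst 𝒰 where
  X := colimit (D ⋙ total 𝒰)
  S i := colimit (D ⋙ fiber 𝒰 i)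
  θ i := colimitθ D i
  θ_over i := by
    refine colimit_prod_hom_ext D fun j => ?_
    exact comp_over_of_comm (ι_colimitθ_hom D i j) ((D.obj j).θ_over i)

/-- The cocone of a colimit of locally constant objects. -/
@[simps]
def colimitCocone : Cocone D where
  pt := colimitObj D
  ι :=
    { app := fun j =>
        { f := colimit.ι (D ⋙ total 𝒰) j
          ϑ := fun i => colimit.ι (D ⋙ fiber 𝒰 i) j
          comm := fun i => (ι_colimitθ_hom D i j).symm }
      naturality := fun j k h => by
        ext1
        · exact (colimit.w (D ⋙ total 𝒰) h).trans (Category.comp_id _).symm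
        · exact (colimit.w (D ⋙ fiber 𝒰 _) h).trans (Category.comp_id _).symm }

/-- The universal property of a colimit of locally constant objects. -/
def colimitCoconeIsColimit : IsColimit (colimitCocone D) where
  desc s :=
    { f := colimit.desc (D ⋙ total 𝒰) ((total 𝒰).mapCocone s)
      ϑ := fun i => colimit.desc (D ⋙ fiber 𝒰 i) ((fiber 𝒰 i).mapCocone s)
      comm := fun i => by
        refine colimit_prod_hom_ext D fun j => ?_
        exact comp_comm_of_comm (colimit.ι_desc _ _) (colimit.ι_desc _ _) ((s.ι.app j).comm i)
          (ι_colimitθ_hom D i j).symm }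
  fac s j := by
    ext1
    · exact colimit.ι_desc _ _
    · exact colimit.ι_desc _ _
  uniq s m hm := by
    ext1
    · exact (colimit.isColimit (D ⋙ total 𝒰)).uniq ((total 𝒰).mapCocone s) _
        fun j => congrArg Hom.f (hm j)
    · exact (colimit.isColimit (D ⋙ fiber 𝒰 _)).uniq ((fiber 𝒰 _).mapCocone s) _
        fun j => congrFun (congrArg Hom.ϑ (hm j)) _

lemma hasColimit : HasColimit D := ⟨⟨⟨_, colimitCoconeIsColimit D⟩⟩⟩

lemma preservesColimit_fiber (i : 𝒰.I) : PreservesColimit D (fiber 𝒰 i) :=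
  preservesColimit_of_preserves_colimit_cocone (colimitCoconeIsColimit D)
    (IsColimit.ofIsoColimit (colimit.isColimit (D ⋙ fiber 𝒰 i)) (Cocone.ext (Iso.refl _) fun _ => Category.comp_id _))

lemma preservesColimit_total : PreservesColimit D (total 𝒰) :=
  preservesColimit_of_preserves_colimit_cocone (colimitCoconeIsColimit D)
    (IsColimit.ofIsoColimit (colimit.isColimit (D ⋙ total 𝒰)) (Cocone.ext (Iso.refl _) fun _ => Category.comp_id _))

end Colimits

end

variable (𝒰) in
/-- The constant objects. -/
@[simps]
def const (P : Type u) : LocConst 𝒰 where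
  X := (constInv E).obj P
  S _ := P
  θ _ := Iso.refl _
  θ_over _ := Category.id_comp _

/-- Arrows between constant objects. -/
def constMap {P Q : Type u} (f : P ⟶ Q) : const 𝒰 P ⟶ const 𝒰 Q where
  f := (constInv E).map f
  ϑ _ := f
  comm _ := (Category.id_comp _).trans (Category.comp_id _).symm

variable (𝒰) in
/-- The constant object on a point is terminal. -/
def constPUnitIsTerminal : IsTerminal (const 𝒰 PUnit.{u + 1}) := by
  have := constInv_preservesFiniteLimits E
  let t : IsTerminal ((constInv E).obj PUnit.{u + 1}) :=
    IsTerminal.isTerminalObj _ _ Types.isTerminalPUnit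
  refine IsTerminal.ofUniqueHom (fun A =>
    { f := t.from A.X
      ϑ := fun i => ↾fun _ => PUnit.unit
      comm := fun i => ?_ }) fun A m => hom_ext (t.hom_ext _ _) fun i => ?_
  · apply Limits.prod.hom_ext
    · exact t.hom_ext _ _
    · exact comp_snd_eq (A.θ_over i)
  · exact ConcreteCategory.hom_ext _ _ fun _ => rfl

instance : HasFiniteLimits (LocConst 𝒰) := by
  have := constInv_preservesFiniteLimits E
  have := fun i => preservesConnectedLimits_prod (𝒰.U i) WalkingCospan
  have : HasTerminal (LocConst 𝒰) := (constPUnitIsTerminal 𝒰).hasTerminal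
  have : HasPullbacks (LocConst 𝒰) := ⟨fun D => hasLimit_of_isConnected D⟩
  exact hasFiniteLimits_of_hasTerminal_and_pullbacks

instance : HasColimitsOfSize.{u, u} (LocConst 𝒰) := by
  have := (constInvAdj E).leftAdjoint_preservesColimits
  have := fun i => preservesColimits_prod (𝒰.U i)
  exact ⟨fun J _ => ⟨fun D => hasColimit D⟩⟩

instance (i : 𝒰.I) : PreservesFiniteLimits (fiber 𝒰 i) := by
  have := constInv_preservesFiniteLimits E
  have := fun i => preservesConnectedLimits_prod (𝒰.U i) WalkingCospan
  have : PreservesLimitsOfShape (Discrete PEmpty.{1}) (fiber 𝒰 i) := by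
    have : HasTerminal (LocConst 𝒰) := (constPUnitIsTerminal 𝒰).hasTerminal
    have : PreservesLimit (Functor.empty (LocConst 𝒰)) (fiber 𝒰 i) := preservesTerminal_of_iso _
      ((fiber 𝒰 i).mapIso (terminalIsTerminal.uniqueUpToIso (constPUnitIsTerminal 𝒰)) ≪≫
        Types.isTerminalPUnit.uniqueUpToIso terminalIsTerminal)
    exact preservesLimitsOfShape_pempty_of_preservesTerminal _
  have : PreservesLimitsOfShape WalkingCospan (fiber 𝒰 i) := ⟨preservesLimit_fiber _ i⟩
  exact preservesFiniteLimits_of_preservesTerminal_and_pullbacks _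

instance (i : 𝒰.I) : PreservesColimitsOfSize.{u, u} (fiber 𝒰 i) := by
  have := (constInvAdj E).leftAdjoint_preservesColimits
  have := fun i => preservesColimits_prod (𝒰.U i)
  exact ⟨fun {J} _ => ⟨fun {D} => preservesColimit_fiber D i⟩⟩

instance : PreservesColimitsOfSize.{u, u} (total 𝒰) := by
  have := (constInvAdj E).leftAdjoint_preservesColimits
  have := fun i => preservesColimits_prod (𝒰.U i)
  exact ⟨fun {J} _ => ⟨fun {D} => preservesColimit_total D⟩⟩

end LocConst
end

noncomputable section

variable {E : Type v} [Category.{u} E] [IsGrothendieckTopos.{u} E]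

/-! ### Local sections of locally constant objects -/

lemma Cover.mem (𝒰 : Cover.{u} E) :
    Sieve.ofArrows 𝒰.U (fun i => terminal.from (𝒰.U i)) ∈ epicTopology E (⊤_ E) :=
  (ofArrows_mem_epicTopology_iff _ _).2 𝒰.epi

namespace LocConst

variable {𝒰 : Cover.{u} E}

/-- An element of the fibre at `i` as a section over `U i`. -/
def sec (A : LocConst 𝒰) {i : 𝒰.I} (x : A.S i) : 𝒰.U i ⟶ A.X :=
  prod.lift (terminal.from _ ≫ constPt x) (𝟙 _) ≫ (A.θ i).hom ≫ prod.fst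

lemma lift_θ (A : LocConst 𝒰) {i : 𝒰.I} (x : A.S i) {C : E} (u : C ⟶ 𝒰.U i) :
    prod.lift (terminal.from C ≫ constPt x) u ≫ (A.θ i).hom = prod.lift (u ≫ A.sec x) u := by
  have h : prod.lift (terminal.from C ≫ constPt x) u =
      u ≫ prod.lift (terminal.from _ ≫ constPt x) (𝟙 _) := by
    apply Limits.prod.hom_ext
    · simp only [prod.lift_fst, Category.assoc]
      rw [← Category.assoc]
      congr 1
      exact Subsingleton.elim _ _
    · simp
  apply Limits.prod.hom_ext
  · rw [prod.lift_fst, h]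
    simp only [sec, Category.assoc]
  · rw [prod.lift_snd, Category.assoc, A.θ_over, prod.lift_snd]

lemma sec_map {A B : LocConst 𝒰} (g : A ⟶ B) {i : 𝒰.I} (x : A.S i) :
    A.sec x ≫ g.f = B.sec (g.ϑ i x) := by
  have h := congrArg (fun k => prod.lift (terminal.from _ ≫ constPt x) (𝟙 _) ≫ k ≫ prod.fst)
    (g.comm i)
  simp only [Category.assoc, prod.map_fst, prod.lift_map_assoc, constPt_map,
    Category.comp_id] at h
  simpa only [sec, Category.assoc] using h

/-- Different elements of a fibre give disjoint sections. -/
lemma sec_injective (A : LocConst 𝒰) {i : 𝒰.I} {x y : A.S i} {C : E} (hC : IsNonemptyObject C)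
    {u : C ⟶ 𝒰.U i} (h : u ≫ A.sec x = u ≫ A.sec y) : x = y := by
  have h' : prod.lift (terminal.from C ≫ constPt x) u =
      prod.lift (terminal.from C ≫ constPt y) u := by
    rw [← cancel_mono (A.θ i).hom, lift_θ, lift_θ, h]
  refine constPt_injective hC ?_
  simpa [prod.lift_fst] using congrArg (· ≫ prod.fst) h'

/-- Arrows into a product with a constant object are locally given by elements. -/
lemma const_local_mem {P : Type u} {C : E} (a : C ⟶ (constInv E).obj P) :
    ∃ S ∈ epicTopology E C, ∀ ⦃D : E⦄ (d : D ⟶ C), S d →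
      ∃ x : P, d ≫ a = terminal.from D ≫ constPt x := by
  refine ⟨_, (epicTopology E).pullback_stable a (constPt_mem P), ?_⟩
  rintro D d ⟨_, k, _, ⟨x⟩, hk⟩
  refine ⟨x, hk.symm.trans ?_⟩
  congr 1
  exact Subsingleton.elim _ _

/-- An arrow to a locally constant object is locally one of its sections. -/
lemma sec_cover (A : LocConst 𝒰) {i : 𝒰.I} {C : E} (a : C ⟶ A.X) (u : C ⟶ 𝒰.U i) :
    ∃ S ∈ epicTopology E C, ∀ ⦃D : E⦄ (d : D ⟶ C), S d →
      ∃ x : A.S i, d ≫ a = (d ≫ u) ≫ A.sec x := by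
  obtain ⟨S, hS, h⟩ := const_local_mem (prod.lift a u ≫ (A.θ i).inv ≫ prod.fst)
  refine ⟨S, hS, fun D d hd => ?_⟩
  obtain ⟨x, hx⟩ := h d hd
  refine ⟨x, ?_⟩
  have hsnd : (A.θ i).inv ≫ prod.snd = prod.snd := by
    rw [Iso.inv_comp_eq, A.θ_over]
  have : d ≫ prod.lift a u ≫ (A.θ i).inv = prod.lift (terminal.from D ≫ constPt x) (d ≫ u) := by
    apply Limits.prod.hom_ext
    · simpa [prod.lift_fst] using hx
    · simp [hsnd, prod.lift_snd]
  have h2 := congrArg (· ≫ (A.θ i).hom ≫ prod.fst) this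
  have h3 := congrArg (· ≫ prod.fst) (A.lift_θ x (d ≫ u))
  simp only [Category.assoc] at h3
  simpa [h3, prod.lift_fst] using h2

/-- A locally constant object is covered by its sections. -/
lemma sec_mem (A : LocConst 𝒰) :
    Sieve.ofArrows (fun p : Σ i, A.S i => 𝒰.U p.1) (fun p => A.sec p.2) ∈
      epicTopology E A.X := by
  refine (epicTopology E).transitive
    ((epicTopology E).pullback_stable (terminal.from A.X) 𝒰.mem) _ ?_
  rintro D a ⟨_, u, _, ⟨i⟩, -⟩
  obtain ⟨S, hS, h⟩ := A.sec_cover a u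
  refine (epicTopology E).superset_covering ?_ hS
  intro D' d hd
  obtain ⟨x, hx⟩ := h d hd
  exact ⟨_, d ≫ u, A.sec x, Presieve.ofArrows.mk (f := fun p : Σ i, A.S i => A.sec p.2) ⟨i, x⟩,
    hx.symm⟩

lemma total_hom_ext (A : LocConst 𝒰) {Z : E} {g h : A.X ⟶ Z}
    (H : ∀ i (x : A.S i), A.sec x ≫ g = A.sec x ≫ h) : g = h := by
  refine eq_of_mem_epicTopology A.sec_mem ?_
  rintro D _ ⟨_, a, _, ⟨p⟩, rfl⟩
  simp [H p.1 p.2]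

/-- An arrow of locally constant objects is determined by its action on the fibres. -/
lemma hom_ext_fiber {A B : LocConst 𝒰} {g h : A ⟶ B} (H : ∀ i, g.ϑ i = h.ϑ i) : g = h :=
  hom_ext (A.total_hom_ext fun i x => by rw [sec_map, sec_map, H]) H

lemma hom_ext_total {A B : LocConst 𝒰} {g h : A ⟶ B} (H : g.f = h.f) : g = h :=
  hom_ext H fun i => ConcreteCategory.hom_ext _ _ fun x =>
    B.sec_injective (𝒰.nonempty i) (u := 𝟙 _) (by rw [← sec_map, ← sec_map, H])

/-- The compatibility with trivializations can be checked on the sections. -/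
lemma comm_of_sec {A B : LocConst 𝒰} (f : A.X ⟶ B.X) {i : 𝒰.I} (ϑ : A.S i ⟶ B.S i)
    (H : ∀ x, A.sec x ≫ f = B.sec (ϑ x)) :
    (A.θ i).hom ≫ prod.map f (𝟙 (𝒰.U i)) =
      prod.map ((constInv E).map ϑ) (𝟙 (𝒰.U i)) ≫ (B.θ i).hom := by
  obtain ⟨S, hS, h⟩ := const_local_mem
    (prod.fst : (constInv E).obj (A.S i) ⨯ 𝒰.U i ⟶ (constInv E).obj (A.S i))
  refine eq_of_mem_epicTopology hS fun D d hd => ?_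
  obtain ⟨x, hx⟩ := h d hd
  have hd' : d = prod.lift (terminal.from D ≫ constPt x) (d ≫ prod.snd) := by
    apply Limits.prod.hom_ext
    · simpa [prod.lift_fst] using hx
    · rw [prod.lift_snd]
  rw [hd', ← Category.assoc, lift_θ, prod.lift_map, ← Category.assoc, prod.lift_map,
    Category.assoc, H, Category.assoc (terminal.from D)]
  erw [constPt_map]
  simp only [Category.comp_id]
  rw [lift_θ, Category.assoc]

/-- Compatible functions between the fibres come from an arrow of locally constant objects. -/
lemma exists_hom {A B : LocConst 𝒰} (ϑ : ∀ i, A.S i → B.S i)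
    (H : ∀ ⦃i j : 𝒰.I⦄ (x : A.S i) (y : A.S j) ⦃C : E⦄ (u : C ⟶ 𝒰.U i) (v : C ⟶ 𝒰.U j),
      IsNonemptyObject C → u ≫ A.sec x = v ≫ A.sec y →
        u ≫ B.sec (ϑ i x) = v ≫ B.sec (ϑ j y)) :
    ∃ g : A ⟶ B, ∀ i x, g.ϑ i x = ϑ i x := by
  have H' : ∀ ⦃i j : 𝒰.I⦄ (x : A.S i) (y : A.S j) ⦃C : E⦄ (u : C ⟶ 𝒰.U i) (v : C ⟶ 𝒰.U j),
      u ≫ A.sec x = v ≫ A.sec y → u ≫ B.sec (ϑ i x) = v ≫ B.sec (ϑ j y) := by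
    intro i j x y C u v h
    by_cases hC : IsNonemptyObject C
    · exact H x y u v hC h
    · exact eq_of_mem_epicTopology (mem_epicTopology_of_not_isNonemptyObject hC ⊥)
        fun _ _ h => h.elim
  have hsh := isSheafFor_of_mem_epicTopology A.sec_mem B.X
  rw [← Presieve.isSheafFor_iff_generate] at hsh
  have hsh' := (Presieve.isSheafFor_arrows_iff _ _).1 hsh
  obtain ⟨f, hf, -⟩ := hsh' (fun p => B.sec (ϑ p.1 p.2))
    (fun p q C u v h => H' p.2 q.2 u v h)
  exact ⟨{ f := f, ϑ := fun i => ↾ϑ i, comm := fun i =>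
    comm_of_sec f (↾ϑ i) fun x => hf ⟨i, x⟩ }, fun _ _ => rfl⟩

/-- Equality of sections can be tested after applying a map which is injective on fibres. -/
lemma sec_eq_of_map {A B : LocConst 𝒰} (g : A ⟶ B) {i j : 𝒰.I} {x : A.S i} {y : A.S j}
    (hg : Function.Injective (g.ϑ j)) {C : E} {u : C ⟶ 𝒰.U i} {v : C ⟶ 𝒰.U j}
    (h : u ≫ B.sec (g.ϑ i x) = v ≫ B.sec (g.ϑ j y)) : u ≫ A.sec x = v ≫ A.sec y := by
  obtain ⟨S, hS, hs⟩ := A.sec_cover (u ≫ A.sec x) v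
  refine eq_of_mem_epicTopology hS fun D d hd => ?_
  by_cases hD : IsNonemptyObject D
  · obtain ⟨y', hy'⟩ := hs d hd
    have : g.ϑ j y' = g.ϑ j y := by
      refine B.sec_injective hD (u := d ≫ v) ?_
      rw [← sec_map, ← Category.assoc, ← hy', Category.assoc, Category.assoc, sec_map, h,
        Category.assoc]
    rw [hy', hg this, Category.assoc]
  · exact eq_of_mem_epicTopology (mem_epicTopology_of_not_isNonemptyObject hD ⊥)
      fun _ _ h => h.elim

variable (𝒰) in
/-- The fibre functors jointly reflect isomorphisms. -/
lemma jointlyReflectIsomorphisms_fiber : JointlyReflectIsomorphisms (fiber 𝒰) where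
  isIso {A B} g hg := by
    have hb : ∀ i, Function.Bijective (g.ϑ i) := fun i => (isIso_iff_bijective _).1 (hg i)
    let e := fun i => Equiv.ofBijective _ (hb i)
    have he : ∀ i y, g.ϑ i ((e i).symm y) = y := fun i y => (e i).apply_symm_apply y
    obtain ⟨h, hh⟩ := exists_hom (A := B) (B := A) (fun i => (e i).symm)
      (fun i j x y C u v _ H => sec_eq_of_map g (hb j).1 (by rw [he, he, H]))
    refine ⟨h, hom_ext_fiber fun i => ConcreteCategory.hom_ext _ _ fun x => ?_,
      hom_ext_fiber fun i => ConcreteCategory.hom_ext _ _ fun x => ?_⟩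
    · exact (hh i _).trans ((e i).symm_apply_apply x)
    · exact (congrArg (g.ϑ i) (hh i x)).trans (he i x)

/-! ### The relation between the elements of the fibres -/

/-- Two elements of fibres are related when the corresponding sections meet. -/
def Rel (A : LocConst 𝒰) (p q : Σ i, A.S i) : Prop :=
  ∃ (C : E) (u : C ⟶ 𝒰.U p.1) (v : C ⟶ 𝒰.U q.1), IsNonemptyObject C ∧
    u ≫ A.sec p.2 = v ≫ A.sec q.2

lemma Rel.symm {A : LocConst 𝒰} {p q : Σ i, A.S i} : A.Rel p q → A.Rel q p :=
  fun ⟨C, u, v, hC, h⟩ => ⟨C, v, u, hC, h.symm⟩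

lemma Rel.map {A B : LocConst 𝒰} (g : A ⟶ B) {i j : 𝒰.I} {x : A.S i} {y : A.S j} :
    A.Rel ⟨i, x⟩ ⟨j, y⟩ → B.Rel ⟨i, g.ϑ i x⟩ ⟨j, g.ϑ j y⟩ := by
  rintro ⟨C, u, v, hC, h⟩
  refine ⟨C, u, v, hC, ?_⟩
  have := congrArg (· ≫ g.f) h
  simpa only [Category.assoc, sec_map] using this

lemma Rel.lift {A B : LocConst 𝒰} (g : A ⟶ B) {i j : 𝒰.I} {x : A.S i} {y : B.S j} :
    B.Rel ⟨i, g.ϑ i x⟩ ⟨j, y⟩ → ∃ y' : A.S j, g.ϑ j y' = y ∧ A.Rel ⟨i, x⟩ ⟨j, y'⟩ := by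
  rintro ⟨C, u, v, hC, h⟩
  obtain ⟨S, hS, hs⟩ := A.sec_cover (u ≫ A.sec x) v
  obtain ⟨D, d, hd, hD⟩ := hC.exists_of_mem hS
  obtain ⟨y', hy'⟩ := hs d hd
  refine ⟨y', B.sec_injective hD (u := d ≫ v) ?_, D, d ≫ u, d ≫ v, hD, by simpa using hy'⟩
  dsimp only at h
  rw [← sec_map, ← Category.assoc, ← hy', Category.assoc, Category.assoc, sec_map, h,
    Category.assoc]

lemma sec_const {P : Type u} (i : 𝒰.I) (x : P) :
    (const 𝒰 P).sec (i := i) x = terminal.from _ ≫ constPt x := by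
  change prod.lift _ _ ≫ 𝟙 _ ≫ prod.fst = _
  rw [Category.id_comp]
  exact prod.lift_fst _ _

lemma comp_sec_const {P : Type u} {i : 𝒰.I} (x : P) {C : E} (u : C ⟶ 𝒰.U i) :
    u ≫ (const 𝒰 P).sec (i := i) x = terminal.from C ≫ constPt x :=
  (congrArg (u ≫ ·) (sec_const i x)).trans ((Category.assoc _ _ _).symm.trans
    (congrArg (· ≫ constPt x) (Subsingleton.elim _ _)))

/-- Functions which are constant on related elements give arrows to constant objects. -/
lemma exists_hom_const (A : LocConst 𝒰) {P : Type u} (φ : (Σ i, A.S i) → P)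
    (hφ : ∀ p q, A.Rel p q → φ p = φ q) :
    ∃ g : A ⟶ const 𝒰 P, ∀ i x, g.ϑ i x = φ ⟨i, x⟩ := by
  refine exists_hom (B := const 𝒰 P) (fun i x => φ ⟨i, x⟩) fun i j x y C u v hC h => ?_
  rw [hφ ⟨i, x⟩ ⟨j, y⟩ ⟨C, u, v, hC, h⟩]
  exact (comp_sec_const _ u).trans (comp_sec_const _ v).symm

/-- A set of elements of the fibres which is closed under the relation is a subobject. -/
lemma exists_sub (A : LocConst 𝒰) (W : (Σ i, A.S i) → Prop)
    (hW : ∀ p q, A.Rel p q → W p → W q) :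
    ∃ (M : LocConst 𝒰) (m : M ⟶ A), ∀ i, Function.Injective (m.ϑ i) ∧
      ∀ x, W ⟨i, x⟩ ↔ ∃ y, m.ϑ i y = x := by
  obtain ⟨g, hg⟩ := A.exists_hom_const (fun p => (ULift.up (W p) : ULift.{u} Prop))
    fun p q h => congrArg ULift.up (propext ⟨hW p q h, hW q p h.symm⟩)
  let t : const 𝒰 PUnit.{u + 1} ⟶ const 𝒰 (ULift.{u} Prop) := constMap (↾fun _ => ⟨True⟩)
  refine ⟨pullback g t, pullback.fst g t, fun i => ?_⟩
  have h := (IsPullback.of_hasPullback g t).map (fiber 𝒰 i)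
  rw [Types.isPullback_iff] at h
  obtain ⟨h₁, h₂, h₃⟩ := h
  refine ⟨fun x y hxy => h₂ x y ⟨hxy, rfl⟩, fun x => ⟨fun hx => ?_, ?_⟩⟩
  · obtain ⟨y, hy, -⟩ := h₃ x PUnit.unit ((hg i x).trans (by
      change ULift.up (W ⟨i, x⟩) = ULift.up True
      rw [eq_true hx]))
    exact ⟨y, hy⟩
  · rintro ⟨y, rfl⟩
    have := (hg i _).symm.trans (ConcreteCategory.congr_hom h₁ y)
    exact of_eq_true (congrArg ULift.down this)

end LocConst
end

noncomputable section

set_option linter.unusedSectionVars false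

/-! ### Categories with enough points -/

namespace FiberFunctors

variable {T : Type v} [Category.{u} T] {I : Type w} {F : I → T ⥤ Type u}

/-- A cocone is a colimit when it is one on all fibres, by the elementwise description of
colimits of sets. -/
lemma nonempty_isColimit (hF : JointlyReflectIsomorphisms F) {J : Type*} [Category* J]
    [HasColimitsOfShape J T] [∀ i, PreservesColimitsOfShape J (F i)]
    [HasColimitsOfShape J (Type u)] {D : J ⥤ T} (c : Cocone D)
    (surj : ∀ i (x : (F i).obj c.pt), ∃ a y, (F i).map (c.ι.app a) y = x)
    (inj : ∀ i a b (x : (F i).obj (D.obj a)) (y : (F i).obj (D.obj b)),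
      (F i).map (c.ι.app a) x = (F i).map (c.ι.app b) y →
        ∃ (d : J) (f : d ⟶ a) (g : d ⟶ b) (z : (F i).obj (D.obj d)),
          (F i).map (D.map f) z = x ∧ (F i).map (D.map g) z = y) :
    Nonempty (IsColimit c) := by
  refine ⟨hF.jointlyReflectsColimit fun i => ?_⟩
  have key : IsIso (colimit.desc (D ⋙ F i) ((F i).mapCocone c)) := by
    rw [isIso_iff_bijective]
    constructor
    · intro x y h
      obtain ⟨a, x, rfl⟩ := Types.jointly_surjective' x
      obtain ⟨b, y, rfl⟩ := Types.jointly_surjective' y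
      rw [colimit.ι_desc_apply, colimit.ι_desc_apply] at h
      obtain ⟨d, f, g, z, rfl, rfl⟩ := inj i a b x y h
      exact (colimit.w_apply (D ⋙ F i) f z).trans
        (colimit.w_apply (D ⋙ F i) g z).symm
    · intro x
      obtain ⟨a, y, rfl⟩ := surj i x
      exact ⟨colimit.ι (D ⋙ F i) a y, colimit.ι_desc_apply (F := D ⋙ F i) ((F i).mapCocone c) a y⟩
  have : IsIso ((colimit.isColimit (D ⋙ F i)).desc ((F i).mapCocone c)) := key
  exact IsColimit.ofPointIso (colimit.isColimit (D ⋙ F i))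

variable [HasFiniteLimits T] [HasColimitsOfSize.{u, u} T] [∀ i, PreservesFiniteLimits (F i)]
  [∀ i, PreservesColimitsOfSize.{u, u} (F i)] {K : Type u} {G : K → T}

variable (F G) in
/-- All points are hit by arrows from the objects `G k`. -/
def Hit : Prop := ∀ A i (x : (F i).obj A), ∃ (k : K) (f : G k ⟶ A) (y : (F i).obj (G k)),
  (F i).map f y = x

lemma exists_pullback_point (hG : Hit F G) {i : I} {A B X : T} {f : A ⟶ X} {g : B ⟶ X}
    {x : (F i).obj A} {y : (F i).obj B} (h : (F i).map f x = (F i).map g y) :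
    ∃ (k : K) (p : G k ⟶ A) (q : G k ⟶ B) (z : (F i).obj (G k)), p ≫ f = q ≫ g ∧
      (F i).map p z = x ∧ (F i).map q z = y := by
  obtain ⟨-, -, hp⟩ := (Types.isPullback_iff _ _ _ _).1 ((IsPullback.of_hasPullback f g).map (F i))
  obtain ⟨w, hw₁, hw₂⟩ := hp x y h
  obtain ⟨k, m, z, rfl⟩ := hG _ i w
  refine ⟨k, m ≫ pullback.fst f g, m ≫ pullback.snd f g, z, ?_, ?_, ?_⟩
  · rw [Category.assoc, Category.assoc, pullback.condition]
  · rw [← hw₁, Functor.map_comp]; rfl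
  · rw [← hw₂, Functor.map_comp]; rfl

lemma exists_equalizer_point (hG : Hit F G) {i : I} {A X : T} {f g : A ⟶ X}
    {x : (F i).obj A} (h : (F i).map f x = (F i).map g x) :
    ∃ (k : K) (p : G k ⟶ A) (z : (F i).obj (G k)), p ≫ f = p ≫ g ∧ (F i).map p z = x := by
  have hl := isLimitForkMapOfIsLimit (F i) _ (equalizerIsEqualizer f g)
  obtain ⟨w, hw, -⟩ := Types.unique_of_type_equalizer _ _ hl x h
  obtain ⟨k, m, z, rfl⟩ := hG _ i w
  refine ⟨k, m ≫ equalizer.ι f g, z, ?_, ?_⟩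
  · rw [Category.assoc, Category.assoc, equalizer.condition]
  · rw [← hw, Functor.map_comp]; rfl

lemma hom_ext (hF : JointlyReflectIsomorphisms F) {A B : T} {f g : A ⟶ B}
    (h : ∀ i (x : (F i).obj A), (F i).map f x = (F i).map g x) : f = g :=
  hF.jointlyFaithful.map_injective fun i => ConcreteCategory.hom_ext _ _ (h i)

/-- The object of the small category of generators given by an index. -/
abbrev genObj (k : K) : InducedCategory T G := k

section Glue

variable {X : T} (S : ∀ ⦃k : K⦄, (G k ⟶ X) → Prop)

/-- The cocone of the arrows from generators to `X` which belong to `S`. -/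
def genCocone : Cocone (ObjectProperty.ι
    (fun a : CostructuredArrow (inducedFunctor G) X => S a.hom) ⋙
      CostructuredArrow.proj _ _ ⋙ inducedFunctor G) where
  pt := X
  ι := { app := fun a => a.obj.hom
         naturality := fun _ _ f => (CostructuredArrow.w f.hom).trans (Category.comp_id _).symm }

lemma nonempty_isColimit_genCocone (hF : JointlyReflectIsomorphisms F) (hG : Hit F G)
    (hS : ∀ ⦃k l : K⦄ (h : G l ⟶ G k) (f : G k ⟶ X), S f → S (h ≫ f))
    (hS' : ∀ i (x : (F i).obj X), ∃ (k : K) (f : G k ⟶ X), S f ∧ ∃ y, (F i).map f y = x) : Nonempty (IsColimit (genCocone S)) := by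
  refine nonempty_isColimit hF _ (fun i x => ?_) (fun i a b x y h => ?_)
  · obtain ⟨k, f, hf, y, hy⟩ := hS' i x
    exact ⟨⟨CostructuredArrow.mk (S := inducedFunctor G) (Y := genObj k) f, hf⟩, y, hy⟩
  · obtain ⟨k, p, q, z, hpq, hx, hy⟩ := exists_pullback_point hG h
    refine ⟨⟨CostructuredArrow.mk (S := inducedFunctor G) (Y := genObj k) (p ≫ a.obj.hom),
      hS p a.obj.hom a.property⟩,
      ObjectProperty.homMk (CostructuredArrow.homMk (InducedCategory.homMk p) rfl),
      ObjectProperty.homMk (CostructuredArrow.homMk (InducedCategory.homMk q) hpq.symm),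
      z, hx, hy⟩

lemma exists_glue (hF : JointlyReflectIsomorphisms F) (hG : Hit F G)
    (hS : ∀ ⦃k l : K⦄ (h : G l ⟶ G k) (f : G k ⟶ X), S f → S (h ≫ f))
    (hS' : ∀ i (x : (F i).obj X), ∃ (k : K) (f : G k ⟶ X), S f ∧ ∃ y, (F i).map f y = x)
    {D : Type*} [Category.{u} D] (H : T ⥤ D) [PreservesColimitsOfSize.{u, u} H]
    {Y : D} (φ : ∀ ⦃k : K⦄ (f : G k ⟶ X), S f → (H.obj (G k) ⟶ Y))
    (hφ : ∀ ⦃k l : K⦄ (h : G l ⟶ G k) (f : G k ⟶ X) (hf : S f),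
      φ (h ≫ f) (hS h f hf) = H.map h ≫ φ f hf) :
    ∃ g : H.obj X ⟶ Y, ∀ ⦃k : K⦄ (f : G k ⟶ X) (hf : S f), H.map f ≫ g = φ f hf := by
  obtain ⟨hc⟩ := nonempty_isColimit_genCocone S hF hG hS hS'
  have hc' := isColimitOfPreserves H hc
  have nat : ∀ ⦃k l : K⦄ (h : G l ⟶ G k) (f : G k ⟶ X) (f' : G l ⟶ X) (hf : S f) (hf' : S f'),
      h ≫ f = f' → H.map h ≫ φ f hf = φ f' hf' := by
    rintro k l h f _ hf hf' rfl
    exact (hφ h f hf).symm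
  let s : Cocone ((ObjectProperty.ι
      (fun a : CostructuredArrow (inducedFunctor G) X => S a.hom) ⋙
      CostructuredArrow.proj _ _ ⋙ inducedFunctor G) ⋙ H) :=
    { pt := Y
      ι := { app := fun a => φ a.obj.hom a.property
             naturality := fun a b f =>
              (nat f.hom.left.hom b.obj.hom a.obj.hom b.property a.property
                (CostructuredArrow.w f.hom)).trans (Category.comp_id _).symm } }
  exact ⟨hc'.desc s, fun k f hf =>
    hc'.fac s ⟨CostructuredArrow.mk (S := inducedFunctor G) (Y := genObj k) f, hf⟩⟩

lemma glue_ext (hF : JointlyReflectIsomorphisms F) (hG : Hit F G)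
    (hS : ∀ ⦃k l : K⦄ (h : G l ⟶ G k) (f : G k ⟶ X), S f → S (h ≫ f))
    (hS' : ∀ i (x : (F i).obj X), ∃ (k : K) (f : G k ⟶ X), S f ∧ ∃ y, (F i).map f y = x)
    {D : Type*} [Category.{u} D] (H : T ⥤ D) [PreservesColimitsOfSize.{u, u} H]
    {Y : D} {g g' : H.obj X ⟶ Y}
    (h : ∀ ⦃k : K⦄ (f : G k ⟶ X), S f → H.map f ≫ g = H.map f ≫ g') : g = g' := by
  obtain ⟨hc⟩ := nonempty_isColimit_genCocone S hF hG hS hS'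
  exact (isColimitOfPreserves H hc).hom_ext fun a => h a.obj.hom a.property

end Glue

/-- A form of the adjoint functor theorem. -/
lemma isLeftAdjoint (hF : JointlyReflectIsomorphisms F) (hG : Hit F G)
    {D : Type*} [Category.{u} D] (H : T ⥤ D) [PreservesColimitsOfSize.{u, u} H] :
    H.IsLeftAdjoint := by
  have hsol : SolutionSetCondition.{u} H.op := by
    intro d
    let ι : InducedCategory T G ⥤ T := inducedFunctor G
    let Q : CostructuredArrow (ι ⋙ H) d.unop ⥤ T := CostructuredArrow.proj _ _ ⋙ ι
    let s : Cocone (Q ⋙ H) :=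
      { pt := d.unop
        ι := { app := fun a => a.hom
               naturality := fun a b f =>
                (CostructuredArrow.w f).trans (Category.comp_id _).symm } }
    have hQ := isColimitOfPreserves H (colimit.isColimit Q)
    have nat : ∀ {a b : CostructuredArrow (ι ⋙ H) d.unop} (h : G a.left ⟶ G b.left),
        H.map h ≫ b.hom = a.hom → h ≫ colimit.ι Q b = colimit.ι Q a := fun {a b} h w =>
      colimit.w Q (CostructuredArrow.homMk (InducedCategory.homMk h) w : a ⟶ b)
    refine ⟨PUnit, fun _ => Opposite.op (colimit Q), fun _ => (hQ.desc s).op, fun X h => ?_⟩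
    let arr : ∀ {k : K}, (G k ⟶ X.unop) → CostructuredArrow (ι ⋙ H) d.unop := fun {k} f =>
      CostructuredArrow.mk (S := ι ⋙ H) (Y := genObj k) (H.map f ≫ h.unop)
    obtain ⟨g, hg⟩ := exists_glue (X := X.unop) (fun _ _ => True) hF hG
      (fun _ _ _ _ _ => trivial) (fun i x => by
        obtain ⟨k, f, y, hy⟩ := hG _ i x
        exact ⟨k, f, trivial, y, hy⟩) (𝟭 T) (fun k f _ => colimit.ι Q (arr f))
      (fun k l p f _ => (nat (a := arr (p ≫ f)) (b := arr f) p (by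
        change H.map p ≫ H.map f ≫ h.unop = H.map (p ≫ f) ≫ h.unop
        rw [H.map_comp, Category.assoc])).symm)
    refine ⟨PUnit.unit, g.op, Quiver.Hom.unop_inj ?_⟩
    change H.map g ≫ hQ.desc s = h.unop
    refine glue_ext (X := X.unop) (fun _ _ => True) hF hG
      (fun _ _ _ _ _ => trivial) (fun i x => by
        obtain ⟨k, f, y, hy⟩ := hG _ i x
        exact ⟨k, f, trivial, y, hy⟩) H (fun k f _ => ?_)
    have hf : f ≫ g = colimit.ι Q (arr f) := hg f trivial
    rw [← Category.assoc, ← H.map_comp, hf]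
    exact hQ.fac s (arr f)
  have : PreservesLimitsOfSize.{u, u} H.op := preservesLimitsOfSize_op H
  have := isRightAdjoint_of_preservesLimits_of_solutionSetCondition H.op hsol
  exact ⟨_, ⟨((Adjunction.ofIsRightAdjoint H.op).unop : _)⟩⟩

end FiberFunctors

end

noncomputable section

set_option linter.unusedSectionVars false

/-! ### A category with enough points and a small hitting family is a Grothendieck topos -/

namespace FiberFunctors

open Opposite

variable {T : Type v} [Category.{u} T] [HasFiniteLimits T] [HasColimitsOfSize.{u, u} T]
  {I : Type w} {F : I → T ⥤ Type u} [∀ i, PreservesFiniteLimits (F i)]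
  [∀ i, PreservesColimitsOfSize.{u, u} (F i)] {K : Type u} {G : K → T}

variable (F) in
/-- The topology of the sieves which hit all points. -/
def hitTopology (hG : Hit F G) : GrothendieckTopology (InducedCategory T G) where
  sieves c := {S | ∀ i (x : (F i).obj (G c)), ∃ (d : K) (f : genObj d ⟶ c), S f ∧
    ∃ y, (F i).map f.hom y = x}
  top_mem' c i x := ⟨c, 𝟙 c, trivial, x, by
    change (F i).map (𝟙 (G c)) x = x
    rw [(F i).map_id]; rfl⟩
  pullback_stable' c d S h hS i x := by
    obtain ⟨e, f, hf, y, hy⟩ := hS i ((F i).map h.hom x)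
    obtain ⟨k, p, q, z, hpq, hp, -⟩ := exists_pullback_point hG hy.symm
    refine ⟨k, InducedCategory.homMk p, ?_, z, hp⟩
    have : (InducedCategory.homMk p : genObj k ⟶ d) ≫ h =
        (InducedCategory.homMk q : genObj k ⟶ genObj e) ≫ f := InducedCategory.hom_ext hpq
    change S (_ ≫ h)
    rw [this]
    exact S.downward_closed hf _
  transitive' c S hS R hR i x := by
    obtain ⟨d, f, hf, y, rfl⟩ := hS i x
    obtain ⟨e, g, hg, z, rfl⟩ := hR hf i y
    exact ⟨e, g ≫ f, hg, z, by
      change (F i).map (g.hom ≫ f.hom) z = _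
      rw [(F i).map_comp]; rfl⟩

lemma isSheaf_genYoneda (hF : JointlyReflectIsomorphisms F) (hG : Hit F G) (X : T) :
    Presieve.IsSheaf (hitTopology F hG) ((inducedFunctor G).op ⋙ yoneda.obj X) := by
  intro c S hS x hx
  have hS₁ : ∀ ⦃k l : K⦄ (h : G l ⟶ G k) (f : G k ⟶ G c),
      S (InducedCategory.homMk f : genObj k ⟶ c) →
      S (InducedCategory.homMk (h ≫ f) : genObj l ⟶ c) := fun k l h f hf =>
    S.downward_closed hf (InducedCategory.homMk h : genObj l ⟶ genObj k)
  have hS₂ : ∀ i (x : (F i).obj (G c)), ∃ (k : K) (f : G k ⟶ G c),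
      S (InducedCategory.homMk f : genObj k ⟶ c) ∧ ∃ y, (F i).map f y = x := fun i x => by
    obtain ⟨d, f, hf, y, hy⟩ := hS i x
    exact ⟨d, f.hom, hf, y, hy⟩
  obtain ⟨g, hg⟩ := exists_glue (X := G c)
    (fun k (f : G k ⟶ G c) => S (InducedCategory.homMk f : genObj k ⟶ c)) hF hG hS₁ hS₂ (𝟭 T)
    (fun k f hf => x _ hf) (fun k l h f hf => by
      exact (hx.to_sieveCompatible (InducedCategory.homMk f : genObj k ⟶ c)
        (InducedCategory.homMk h : genObj l ⟶ genObj k) hf))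
  refine ⟨g, fun d f hf => hg f.hom hf, fun g' hg' => ?_⟩
  exact glue_ext (X := G c)
    (fun k (f : G k ⟶ G c) => S (InducedCategory.homMk f : genObj k ⟶ c)) hF hG hS₁ hS₂ (𝟭 T)
    fun k f hf => (hg' _ hf).trans (hg f hf).symm

variable (hF : JointlyReflectIsomorphisms F) (hG : Hit F G)

/-- The restricted Yoneda embedding into sheaves on the generators. -/
def genYoneda : T ⥤ Sheaf (hitTopology F hG) (Type u) :=
  ObjectProperty.lift _ (yoneda ⋙ (Functor.whiskeringLeft _ _ _).obj (inducedFunctor G).op)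
    fun X => (isSheaf_iff_isSheaf_of_type _ _).2 (isSheaf_genYoneda hF hG X)

lemma hit_top (hG : Hit F G) (X : T) (i : I) (x : (F i).obj X) :
    ∃ (k : K) (f : G k ⟶ X), True ∧ ∃ y, (F i).map f y = x := by
  obtain ⟨k, f, y, hy⟩ := hG _ i x
  exact ⟨k, f, trivial, y, hy⟩

instance : (genYoneda hF hG).Faithful where
  map_injective {X Y} f g h := by
    refine glue_ext (X := X) (fun _ _ => True) hF hG (fun _ _ _ _ _ => trivial)
      (hit_top hG X) (𝟭 T) fun k p _ => ?_
    have h' := congrArg (fun t : (genYoneda hF hG).obj X ⟶ (genYoneda hF hG).obj Y =>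
      t.hom.app (op (genObj k))) h
    exact ConcreteCategory.congr_hom h' p

instance : (genYoneda hF hG).Full where
  map_surjective {X Y} φ := by
    obtain ⟨g, hg⟩ := exists_glue (X := X) (fun _ _ => True) hF hG (fun _ _ _ _ _ => trivial)
      (hit_top hG X) (𝟭 T) (Y := Y) (fun k f _ => φ.hom.app (op (genObj k)) f)
      (fun k l h f _ => ConcreteCategory.congr_hom
        (φ.hom.naturality (InducedCategory.homMk h : genObj l ⟶ genObj k).op) f)
    refine ⟨g, ?_⟩
    apply ObjectProperty.hom_ext
    exact NatTrans.ext (funext fun c => ConcreteCategory.hom_ext _ _ fun f => hg f trivial)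

section Realization

variable (P : (InducedCategory T G)ᵒᵖ ⥤ Type u)

/-- The colimit of the generators over the elements of a presheaf. -/
def realizationDiagram : P.Elementsᵒᵖ ⥤ T :=
  (CategoryOfElements.π P).leftOp ⋙ inducedFunctor G

/-- The arrow to the realization given by an element. -/
def elt {k : K} (p : P.obj (op (genObj k))) : G k ⟶ colimit (realizationDiagram P) :=
  colimit.ι (realizationDiagram P) (op ⟨op (genObj k), p⟩)

lemma comp_elt {k l : K} (h : G l ⟶ G k) (p : P.obj (op (genObj k))) :
    h ≫ elt P p = elt P (P.map (InducedCategory.homMk h : genObj l ⟶ genObj k).op p) :=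
  colimit.w (realizationDiagram P)
    (CategoryOfElements.homMk (F := P) ⟨op (genObj k), p⟩ ⟨op (genObj l), _⟩
      (InducedCategory.homMk h : genObj l ⟶ genObj k).op rfl).op

lemma exists_elt {i : I} (x : (F i).obj (colimit (realizationDiagram P))) :
    ∃ (k : K) (p : P.obj (op (genObj k))) (y : (F i).obj (G k)), (F i).map (elt P p) y = x := by
  obtain ⟨a, y, hy⟩ := Types.jointly_surjective_of_isColimit
    (isColimitOfPreserves (F i) (colimit.isColimit (realizationDiagram P))) x
  exact ⟨a.unop.1.unop, a.unop.2, y, hy⟩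

lemma elt_eq_elt (hG : Hit F G) {i : I} {k l : K} {p : P.obj (op (genObj k))}
    {q : P.obj (op (genObj l))} {x : (F i).obj (G k)} {y : (F i).obj (G l)}
    (h : (F i).map (elt P p) x = (F i).map (elt P q) y) :
    ∃ (e : K) (f : G e ⟶ G k) (g : G e ⟶ G l) (z : (F i).obj (G e)),
      P.map (InducedCategory.homMk f : genObj e ⟶ genObj k).op p =
        P.map (InducedCategory.homMk g : genObj e ⟶ genObj l).op q ∧
      (F i).map f z = x ∧ (F i).map g z = y := by
  let Pt := Σ (k : K) (_ : P.obj (op (genObj k))), (F i).obj (G k)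
  let R : Pt → Pt → Prop := fun a b => ∃ (e : K) (f : G e ⟶ G a.1) (g : G e ⟶ G b.1)
      (z : (F i).obj (G e)),
      P.map (InducedCategory.homMk f : genObj e ⟶ genObj a.1).op a.2.1 =
        P.map (InducedCategory.homMk g : genObj e ⟶ genObj b.1).op b.2.1 ∧
      (F i).map f z = a.2.2 ∧ (F i).map g z = b.2.2
  have mapc : ∀ {a b c : K} (f : G b ⟶ G c) (g : G a ⟶ G b) (p : P.obj (op (genObj c))),
      P.map (InducedCategory.homMk (g ≫ f) : genObj a ⟶ genObj c).op p =
        P.map (InducedCategory.homMk g : genObj a ⟶ genObj b).op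
          (P.map (InducedCategory.homMk f : genObj b ⟶ genObj c).op p) := fun {a b c} f g p =>
    ConcreteCategory.congr_hom (P.map_comp (InducedCategory.homMk f : genObj b ⟶ genObj c).op
      (InducedCategory.homMk g : genObj a ⟶ genObj b).op) p
  have mapF : ∀ {A B C : T} (f : A ⟶ B) (g : B ⟶ C) (x : (F i).obj A),
      (F i).map (f ≫ g) x = (F i).map g ((F i).map f x) := fun f g x =>
    ConcreteCategory.congr_hom ((F i).map_comp f g) x
  have mapid : ∀ {A : T} (x : (F i).obj A), (F i).map (𝟙 A) x = x := fun x =>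
    ConcreteCategory.congr_hom ((F i).map_id _) x
  have hR : Equivalence R := by
    refine ⟨fun a => ⟨a.1, 𝟙 _, 𝟙 _, a.2.2, rfl, mapid _, mapid _⟩, ?_, ?_⟩
    · rintro a b ⟨e, f, g, z, h₁, h₂, h₃⟩
      exact ⟨e, g, f, z, h₁.symm, h₃, h₂⟩
    · rintro a b c ⟨e, f, g, z, h₁, h₂, h₃⟩ ⟨e', f', g', z', h₁', h₂', h₃'⟩
      obtain ⟨m, r, s, w, hrs, hr, hs⟩ := exists_pullback_point hG (h₃.trans h₂'.symm)
      refine ⟨m, r ≫ f, s ≫ g', w, ?_, ?_, ?_⟩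
      · rw [mapc, h₁, ← mapc, hrs, mapc, h₁', ← mapc]
      · rw [mapF, hr, h₂]
      · rw [mapF, hs, h₃']
  let st : Setoid Pt := ⟨R, hR⟩
  let s : Cocone (realizationDiagram P ⋙ F i) :=
    { pt := Quotient st
      ι := { app := fun a => ↾fun y : (F i).obj (G a.unop.1.unop) =>
              (Quotient.mk st ⟨a.unop.1.unop, a.unop.2, y⟩)
             naturality := fun a b f => by
              refine ConcreteCategory.hom_ext _ _ fun y => Quotient.sound ?_
              refine ⟨a.unop.1.unop, f.unop.1.unop.hom, 𝟙 _, y, ?_, rfl, mapid _⟩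
              have h₁ : P.map (𝟙 a.unop.1) a.unop.2 = a.unop.2 :=
                ConcreteCategory.congr_hom (P.map_id _) a.unop.2
              exact f.unop.2.trans h₁.symm } }
  have hs := isColimitOfPreserves (F i) (colimit.isColimit (realizationDiagram P))
  have fac : ∀ {k : K} (p : P.obj (op (genObj k))) (x : (F i).obj (G k)),
      hs.desc s ((F i).map (elt P p) x) = Quotient.mk st ⟨k, p, x⟩ := fun {k} p x =>
    ConcreteCategory.congr_hom (hs.fac s (op ⟨op (genObj k), p⟩)) x
  exact Quotient.exact ((fac p x).symm.trans ((congrArg (hs.desc s) h).trans (fac q y)))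

end Realization

lemma elt_injective (hG : Hit F G) (P : Sheaf (hitTopology F hG) (Type u)) {k : K}
    {p q : P.obj.obj (op (genObj k))} (h : elt P.obj p = elt P.obj q) : p = q := by
  let S : Sieve (genObj k : InducedCategory T G) :=
    { arrows := fun d f => P.obj.map f.op p = P.obj.map f.op q
      downward_closed := fun {Y Z f} hf g => by
        rw [op_comp, P.obj.map_comp]
        exact congrArg (P.obj.map g.op) hf }
  have hS : S ∈ hitTopology F hG (genObj k) := by
    intro i x
    obtain ⟨e, f, g, z, h₁, rfl, h₂⟩ := elt_eq_elt P.obj hG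
      (ConcreteCategory.congr_hom (congrArg (F i).map h) x)
    obtain ⟨d, m, w, hm, rfl⟩ := exists_equalizer_point hG h₂.symm
    refine ⟨d, InducedCategory.homMk (m ≫ f), ?_, w,
      ConcreteCategory.congr_hom ((F i).map_comp m f) w⟩
    have e₁ := congrArg (P.obj.map (InducedCategory.homMk m : genObj d ⟶ genObj e).op) h₁
    have e₂ := ConcreteCategory.congr_hom
      (P.obj.map_comp (InducedCategory.homMk f : genObj e ⟶ genObj k).op
      (InducedCategory.homMk m : genObj d ⟶ genObj e).op) p
    have e₃ := ConcreteCategory.congr_hom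
      (P.obj.map_comp (InducedCategory.homMk g : genObj e ⟶ genObj k).op
      (InducedCategory.homMk m : genObj d ⟶ genObj e).op) q
    have e₄ : (InducedCategory.homMk f : genObj e ⟶ genObj k).op ≫
        (InducedCategory.homMk m : genObj d ⟶ genObj e).op =
        (InducedCategory.homMk g : genObj e ⟶ genObj k).op ≫
        (InducedCategory.homMk m : genObj d ⟶ genObj e).op :=
      congrArg Quiver.Hom.op (InducedCategory.hom_ext hm)
    exact e₂.trans (e₁.trans (e₃.symm.trans
      (ConcreteCategory.congr_hom (congrArg P.obj.map e₄.symm) q)))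
  exact (((isSheaf_iff_isSheaf_of_type _ _).1 P.property).isSeparated S hS).ext
    fun d f hf => hf

lemma elt_surjective (hF : JointlyReflectIsomorphisms F) (hG : Hit F G)
    (P : Sheaf (hitTopology F hG) (Type u)) {k : K}
    (g : G k ⟶ colimit (realizationDiagram P.obj)) : ∃ p : P.obj.obj (op (genObj k)),
      elt P.obj p = g := by
  let S : Sieve (genObj k : InducedCategory T G) :=
    { arrows := fun d f => ∃ q : P.obj.obj (op d), f.hom ≫ g = elt P.obj q
      downward_closed := by
        rintro Y Z f ⟨q, hq⟩ h
        refine ⟨P.obj.map h.op q, ?_⟩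
        refine (Category.assoc h.hom f.hom g).trans ?_
        rw [hq]
        exact comp_elt P.obj h.hom q }
  have hS : S ∈ hitTopology F hG (genObj k) := by
    intro i x
    obtain ⟨l, q, y, hy⟩ := exists_elt P.obj ((F i).map g x)
    obtain ⟨e, m, n, z, hmn, hz, -⟩ := exists_pullback_point hG hy.symm
    exact ⟨e, InducedCategory.homMk m, ⟨_, hmn.trans (comp_elt P.obj n q)⟩, z, hz⟩
  choose φ hφ using fun d (f : d ⟶ genObj k) (hf : S f) => hf
  have hc : Presieve.FamilyOfElements.Compatible (P := P.obj) (R := S.arrows)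
      (fun d f hf => φ d f hf) := by
    refine (Presieve.compatible_iff_sieveCompatible _).2 fun Y Z f h hf => ?_
    apply elt_injective hG P
    refine (hφ _ _ _).symm.trans ?_
    refine (Category.assoc h.hom f.hom g).trans ?_
    rw [hφ Y f hf]
    exact comp_elt P.obj h.hom _
  obtain ⟨p, hp, -⟩ := ((isSheaf_iff_isSheaf_of_type _ _).1 P.property) S hS _ hc
  refine ⟨p, hom_ext hF fun i x => ?_⟩
  obtain ⟨d, f, hf, y, rfl⟩ := hS i x
  have : f.hom ≫ elt P.obj p = f.hom ≫ g := by
    rw [hφ d f hf]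
    refine (comp_elt P.obj f.hom p).trans ?_
    exact congrArg (elt P.obj) (hp f hf)
  exact (ConcreteCategory.congr_hom ((F i).map_comp f.hom (elt P.obj p)) y).symm.trans
    ((ConcreteCategory.congr_hom (congrArg (F i).map this) y).trans
      (ConcreteCategory.congr_hom ((F i).map_comp f.hom g) y))

instance : (genYoneda hF hG).EssSurj where
  mem_essImage P := by
    let α : P.obj ⟶ ((genYoneda hF hG).obj (colimit (realizationDiagram P.obj))).obj :=
      { app := fun c => ↾fun p => elt P.obj (k := c.unop) p
        naturality := fun c d f => ConcreteCategory.hom_ext _ _ fun p =>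
          (comp_elt P.obj (k := c.unop) (l := d.unop) f.unop.hom p).symm }
    have : IsIso α := by
      rw [NatTrans.isIso_iff_isIso_app]
      intro c
      rw [isIso_iff_bijective]
      exact ⟨fun p q h => elt_injective hG P h, fun g => elt_surjective hF hG P g⟩
    exact ⟨_, ⟨(ObjectProperty.isoMk _ (asIso α)).symm⟩⟩

instance : (genYoneda hF hG).IsEquivalence where

theorem isGrothendieckTopos (hF : JointlyReflectIsomorphisms F) (hG : Hit F G) :
    IsGrothendieckTopos.{u} T where
  exists_site := ⟨InducedCategory T G, inferInstance, hitTopology F hG,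
    ⟨(genYoneda hF hG).asEquivalence⟩⟩

end FiberFunctors

end

noncomputable section

set_option linter.unusedSectionVars false

/-! ### Fibre functors with an orbit relation -/

namespace FiberFunctors

variable {T : Type v} [Category.{u} T] {I : Type u} {F : I → T ⥤ Type u}

lemma map_comp_apply (i : I) {A B C : T} (f : A ⟶ B) (g : B ⟶ C) (x : (F i).obj A) :
    (F i).map (f ≫ g) x = (F i).map g ((F i).map f x) :=
  ConcreteCategory.congr_hom ((F i).map_comp f g) x

lemma isColimit_cofan [HasColimitsOfSize.{u, u} T]
    [∀ i, PreservesColimitsOfSize.{u, u} (F i)] (hF : JointlyReflectIsomorphisms F) {K : Type u} {A : T} {B : K → T}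
    (b : ∀ k, B k ⟶ A)
    (surj : ∀ i (x : (F i).obj A), ∃ k y, (F i).map (b k) y = x)
    (inj : ∀ i k l (x : (F i).obj (B k)) (y : (F i).obj (B l)),
      (F i).map (b k) x = (F i).map (b l) y → k = l)
    (inj' : ∀ i k, Function.Injective ((F i).map (b k))) :
    Nonempty (IsColimit (Cofan.mk A b)) := by
  refine nonempty_isColimit hF _ (fun i x => ?_) ?_
  · obtain ⟨k, y, h⟩ := surj i x
    exact ⟨⟨k⟩, y, h⟩
  · rintro i ⟨k⟩ ⟨l⟩ x y h
    obtain rfl := inj i k l x y h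
    obtain rfl := inj' i k h
    exact ⟨⟨k⟩, 𝟙 _, 𝟙 _, x, ConcreteCategory.congr_hom ((F i).map_id _) x,
      ConcreteCategory.congr_hom ((F i).map_id _) x⟩

variable [IsGrothendieckTopos.{u} T] [∀ i, PreservesFiniteLimits (F i)]
  [∀ i, PreservesColimitsOfSize.{u, u} (F i)]

lemma injective_of_mono {A B : T} (m : A ⟶ B) [Mono m] (i : I) :
    Function.Injective ((F i).map m) :=
  (mono_iff_injective _).1 inferInstance

lemma mono_of_injective (hF : JointlyReflectIsomorphisms F) {A B : T} {m : A ⟶ B}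
    (h : ∀ i, Function.Injective ((F i).map m)) : Mono m := by
  have : ∀ i, Mono ((F i).map m) := fun i => (mono_iff_injective _).2 (h i)
  exact hF.mono m

lemma isColimit_binaryCofan (hF : JointlyReflectIsomorphisms F) {A B C : T}
    (f : B ⟶ A) (g : C ⟶ A)
    (surj : ∀ i (x : (F i).obj A), (∃ y, (F i).map f y = x) ∨ (∃ y, (F i).map g y = x))
    (disj : ∀ i x y, (F i).map f x ≠ (F i).map g y)
    (hf : ∀ i, Function.Injective ((F i).map f)) (hg : ∀ i, Function.Injective ((F i).map g)) :
    Nonempty (IsColimit (BinaryCofan.mk f g)) := by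
  refine nonempty_isColimit hF _ (fun i x => ?_) ?_
  · obtain ⟨y, h⟩ | ⟨y, h⟩ := surj i x
    · exact ⟨⟨WalkingPair.left⟩, y, h⟩
    · exact ⟨⟨WalkingPair.right⟩, y, h⟩
  · have key : ∀ i (a : Discrete WalkingPair) (x y : (F i).obj ((pair B C).obj a)), x = y →
        ∃ (d : Discrete WalkingPair) (f : d ⟶ a) (g : d ⟶ a) (z : (F i).obj ((pair B C).obj d)),
          (F i).map ((pair B C).map f) z = x ∧ (F i).map ((pair B C).map g) z = y := by
      rintro i a x _ rfl
      refine ⟨a, 𝟙 _, 𝟙 _, x, ?_, ?_⟩ <;>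
      · rw [(pair B C).map_id, (F i).map_id]
        rfl
    rintro i ⟨_ | _⟩ ⟨_ | _⟩ x y h
    · exact key i _ x y (hf i h)
    · exact (disj i x y h).elim
    · exact (disj i y x h.symm).elim
    · exact key i _ x y (hg i h)

lemma isPullback_iff (hF : JointlyReflectIsomorphisms F) {X₁ X₂ X₃ X₄ : T} {t : X₁ ⟶ X₂}
    {l : X₁ ⟶ X₃} {r : X₂ ⟶ X₄} {b : X₃ ⟶ X₄} :
    IsPullback t l r b ↔ ∀ i, (∀ x, (F i).map r ((F i).map t x) = (F i).map b ((F i).map l x)) ∧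
      (∀ x y, (F i).map t x = (F i).map t y → (F i).map l x = (F i).map l y → x = y) ∧
      ∀ x y, (F i).map r x = (F i).map b y → ∃ z, (F i).map t z = x ∧ (F i).map l z = y := by
  constructor
  · intro h i
    obtain ⟨h₁, h₂, h₃⟩ := (Types.isPullback_iff _ _ _ _).1 (h.map (F i))
    exact ⟨fun x => ConcreteCategory.congr_hom h₁ x, fun x y e e' => h₂ x y ⟨e, e'⟩, h₃⟩
  · intro h
    have w : t ≫ r = l ≫ b := hom_ext hF fun i x => by
      rw [map_comp_apply, map_comp_apply, (h i).1]
    have : IsIso (pullback.lift t l w) := by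
      refine (hF.isIso_iff _).2 fun i => (isIso_iff_bijective _).2 ?_
      have hp := (Types.isPullback_iff _ _ _ _).1 ((IsPullback.of_hasPullback r b).map (F i))
      have h₁ : ∀ x, (F i).map (pullback.fst r b) ((F i).map (pullback.lift t l w) x) =
          (F i).map t x := fun x => by rw [← map_comp_apply, pullback.lift_fst]
      have h₂ : ∀ x, (F i).map (pullback.snd r b) ((F i).map (pullback.lift t l w) x) =
          (F i).map l x := fun x => by rw [← map_comp_apply, pullback.lift_snd]
      refine ⟨fun x y e => (h i).2.1 x y ?_ ?_, fun y => ?_⟩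
      · rw [← h₁, ← h₁, e]
      · rw [← h₂, ← h₂, e]
      · obtain ⟨z, hz, hz'⟩ := (h i).2.2 ((F i).map (pullback.fst r b) y)
          ((F i).map (pullback.snd r b) y) (ConcreteCategory.congr_hom hp.1 y)
        exact ⟨z, hp.2.1 _ _ ⟨(h₁ z).trans hz, (h₂ z).trans hz'⟩⟩
    exact IsPullback.of_iso_pullback ⟨w⟩ (asIso (pullback.lift t l w))
      (pullback.lift_fst _ _ _) (pullback.lift_snd _ _ _)

lemma isRelation_iff (hF : JointlyReflectIsomorphisms F) {R A B : T} {r : R ⟶ A} {s : R ⟶ B} :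
    IsRelation r s ↔ ∀ i (x y : (F i).obj R), (F i).map r x = (F i).map r y →
      (F i).map s x = (F i).map s y → x = y := by
  constructor
  · intro h i
    have hm : Mono (prod.lift r s) := ⟨fun f g e => h f g
      (by simpa [prod.lift_fst] using congrArg (· ≫ prod.fst) e)
      (by simpa [prod.lift_snd] using congrArg (· ≫ prod.snd) e)⟩
    intro x y h₁ h₂
    refine injective_of_mono (F := F) (prod.lift r s) i ?_
    have hl := mapIsLimitOfPreservesOfIsLimit (F i) _ _ (prodIsProd A B)
    have : (↾fun _ : PUnit.{u + 1} => (F i).map (prod.lift r s) x) =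
        (↾fun _ => (F i).map (prod.lift r s) y) := by
      refine BinaryFan.IsLimit.hom_ext hl ?_ ?_
      · refine ConcreteCategory.hom_ext _ _ fun _ => ?_
        change (F i).map prod.fst ((F i).map (prod.lift r s) x) =
          (F i).map prod.fst ((F i).map (prod.lift r s) y)
        rw [← map_comp_apply, ← map_comp_apply, prod.lift_fst, h₁]
      · refine ConcreteCategory.hom_ext _ _ fun _ => ?_
        change (F i).map prod.snd ((F i).map (prod.lift r s) x) =
          (F i).map prod.snd ((F i).map (prod.lift r s) y)
        rw [← map_comp_apply, ← map_comp_apply, prod.lift_snd, h₂]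
    exact ConcreteCategory.congr_hom this PUnit.unit
  · intro h Z f g e e'
    refine hom_ext hF fun i x => h i _ _ ?_ ?_
    · rw [← map_comp_apply, ← map_comp_apply, e]
    · rw [← map_comp_apply, ← map_comp_apply, e']

section Const

/-- The only element of a fibre of the terminal object. -/
def star (F : I → T ⥤ Type u) [∀ i, PreservesFiniteLimits (F i)] (i : I) : (F i).obj (⊤_ T) :=
  (IsTerminal.isTerminalObj (F i) _ terminalIsTerminal).from PUnit PUnit.unit

lemma eq_star (i : I) (x : (F i).obj (⊤_ T)) : x = star F i :=
  ConcreteCategory.congr_hom ((IsTerminal.isTerminalObj (F i) _ terminalIsTerminal).hom_ext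
    (↾fun _ : PUnit.{u + 1} => x)
    ((IsTerminal.isTerminalObj (F i) _ terminalIsTerminal).from PUnit)) PUnit.unit

/-- The element of a fibre of a constant object given by an element of the set. -/
def pt (F : I → T ⥤ Type u) [∀ i, PreservesFiniteLimits (F i)] (i : I) {P : Type u} (x : P) :
    (F i).obj ((constInv T).obj P) := (F i).map (constPt x) (star F i)

lemma map_pt (i : I) {P Q : Type u} (f : P ⟶ Q) (x : P) :
    (F i).map ((constInv T).map f) (pt F i x) = pt F i (f x) := by
  rw [pt, ← map_comp_apply, constPt_map]
  rfl

lemma pt_bijective (i : I) (P : Type u) :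
    Function.Bijective (pt F i : P → (F i).obj ((constInv T).obj P)) := by
  have hc := isColimitOfPreserves (F i) (coproductIsCoproduct (fun _ : P => ⊤_ T))
  constructor
  · let s : Cocone (Discrete.functor (fun _ : P => ⊤_ T) ⋙ F i) :=
      { pt := P
        ι := { app := fun a => ↾fun _ => a.as
               naturality := by
                rintro ⟨a⟩ ⟨b⟩ ⟨⟨h⟩⟩
                obtain rfl : a = b := h
                rfl } }
    have fac : ∀ x : P, hc.desc s (pt F i x) = x := fun x =>
      ConcreteCategory.congr_hom (hc.fac s ⟨x⟩) (star F i)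
    exact fun x y h => (fac x).symm.trans ((congrArg (hc.desc s) h).trans (fac y))
  · intro y
    obtain ⟨⟨x⟩, z, hz⟩ := Types.jointly_surjective_of_isColimit hc y
    refine ⟨x, hz ▸ ?_⟩
    rw [eq_star i z]
    rfl

/-- The elements of the fibres of a constant object are the elements of the set. -/
def ptEquiv (F : I → T ⥤ Type u) [∀ i, PreservesFiniteLimits (F i)]
    [∀ i, PreservesColimitsOfSize.{u, u} (F i)] (i : I) (P : Type u) :
    P ≃ (F i).obj ((constInv T).obj P) := Equiv.ofBijective _ (pt_bijective i P)

end Const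

end FiberFunctors

end

noncomputable section

set_option linter.unusedSectionVars false

/-! ### Atomicity from an orbit relation -/

namespace FiberFunctors

variable {T : Type v} [Category.{u} T] {I : Type u} {F : I → T ⥤ Type u}

variable (F) in
/-- A relation between the points of each object whose invariant subsets are the subobjects and
along which points lift. -/
structure OrbitRelation where
  rel (A : T) : (Σ i, (F i).obj A) → (Σ i, (F i).obj A) → Prop
  symm {A : T} {p q : Σ i, (F i).obj A} : rel A p q → rel A q p
  map {A B : T} (g : A ⟶ B) {p q : Σ i, (F i).obj A} : rel A p q →
    rel B ⟨p.1, (F p.1).map g p.2⟩ ⟨q.1, (F q.1).map g q.2⟩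
  lift {A B : T} (g : A ⟶ B) {p : Σ i, (F i).obj A} {q : Σ i, (F i).obj B} :
    rel B ⟨p.1, (F p.1).map g p.2⟩ q → ∃ q' : (F q.1).obj A, (F q.1).map g q' = q.2 ∧
      rel A p ⟨q.1, q'⟩
  sub {A : T} (W : (Σ i, (F i).obj A) → Prop) : (∀ p q, rel A p q → W p → W q) →
    ∃ (M : T) (m : M ⟶ A), ∀ i, Function.Injective ((F i).map m) ∧
      ∀ x, W ⟨i, x⟩ ↔ ∃ y, (F i).map m y = x

namespace OrbitRelation

variable [IsGrothendieckTopos.{u} T] [∀ i, PreservesFiniteLimits (F i)]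
  [∀ i, PreservesColimitsOfSize.{u, u} (F i)]

theorem isBooleanTopos (R : OrbitRelation F) (hF : JointlyReflectIsomorphisms F) :
    IsBooleanTopos T := by
  intro X Y m hm
  obtain ⟨Z, n, hn⟩ := R.sub (A := X) (fun p => ¬ ∃ y, (F p.1).map m y = p.2) (by
    rintro ⟨i, x⟩ ⟨j, y⟩ h hp hy
    obtain ⟨y', rfl⟩ : ∃ y' : (F j).obj Y, (F j).map m y' = y := hy
    obtain ⟨x', hx', -⟩ := R.lift m (p := ⟨j, y'⟩) (R.symm h)
    exact hp ⟨x', hx'⟩)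
  refine ⟨Z, n, mono_of_injective hF fun i => (hn i).1, ?_⟩
  refine isColimit_binaryCofan hF m n (fun i x => ?_) (fun i x y h => ?_)
    (injective_of_mono m) fun i => (hn i).1
  · by_cases hx : ∃ y, (F i).map m y = x
    · exact Or.inl hx
    · exact Or.inr (((hn i).2 x).1 hx)
  · exact ((hn i).2 _).2 ⟨y, rfl⟩ ⟨x, h⟩

lemma eq_of_rel_pt (R : OrbitRelation F) {P : Type u} {i j : I} {x y : P}
    (h : R.rel ((constInv T).obj P) ⟨i, pt F i x⟩ ⟨j, pt F j y⟩) : x = y := by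
  obtain ⟨z, hz, -⟩ := R.lift (constPt x) (p := ⟨i, star F i⟩) h
  rw [eq_star j z] at hz
  exact (pt_bijective j P).1 hz

lemma symm_eq_of_rel (R : OrbitRelation F) {P : Type u}
    {p q : Σ i, (F i).obj ((constInv T).obj P)} (h : R.rel _ p q) :
    (ptEquiv F p.1 P).symm p.2 = (ptEquiv F q.1 P).symm q.2 := by
  refine R.eq_of_rel_pt (i := p.1) (j := q.1) ?_
  have hp : pt F p.1 ((ptEquiv F p.1 P).symm p.2) = p.2 := (ptEquiv F p.1 P).apply_symm_apply p.2
  have hq : pt F q.1 ((ptEquiv F q.1 P).symm q.2) = q.2 := (ptEquiv F q.1 P).apply_symm_apply q.2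
  rw [hp, hq]
  exact h

lemma exists_hom_const (R : OrbitRelation F) (hF : JointlyReflectIsomorphisms F) {A : T}
    {P : Type u} (φ : (Σ i, (F i).obj A) → P) (hφ : ∀ p q, R.rel A p q → φ p = φ q) :
    ∃ g : A ⟶ (constInv T).obj P, ∀ i x, (F i).map g x = pt F i (φ ⟨i, x⟩) := by
  choose M m hm using fun a : P => R.sub (A := A) (fun p => φ p = a)
    fun p q h hp => (hφ p q h).symm.trans hp
  obtain ⟨hc⟩ := isColimit_cofan hF m (fun i x => ⟨φ ⟨i, x⟩, ((hm _ i).2 x).1 rfl⟩)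
    (fun i k l x y h => ((((hm k i).2 _).2 ⟨x, rfl⟩).symm.trans (((hm l i).2 _).2 ⟨y, h.symm⟩)))
    fun i k => (hm k i).1
  refine ⟨Cofan.IsColimit.desc hc fun a => terminal.from (M a) ≫ constPt a, fun i x => ?_⟩
  obtain ⟨y, hy⟩ := ((hm (φ ⟨i, x⟩) i).2 x).1 rfl
  have fac : m (φ ⟨i, x⟩) ≫ Cofan.IsColimit.desc hc (fun a => terminal.from (M a) ≫ constPt a) =
      terminal.from _ ≫ constPt (φ ⟨i, x⟩) := Cofan.IsColimit.fac hc _ _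
  calc _ = (F i).map (Cofan.IsColimit.desc hc fun a => terminal.from (M a) ≫ constPt a)
        ((F i).map (m (φ ⟨i, x⟩)) y) := by rw [hy]
    _ = (F i).map (terminal.from _ ≫ constPt (φ ⟨i, x⟩)) y := by rw [← map_comp_apply, fac]
    _ = _ := by rw [map_comp_apply, eq_star i ((F i).map (terminal.from _) y)]; rfl

end OrbitRelation

lemma eq_of_isRelation {R A B : Type u} {r : R ⟶ A} {s : R ⟶ B} (h : IsRelation r s)
    {x y : R} (h₁ : r x = r y) (h₂ : s x = s y) : x = y :=
  ConcreteCategory.congr_hom (h (↾fun _ : PUnit.{u + 1} => x) (↾fun _ => y)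
    (ConcreteCategory.hom_ext _ _ fun _ => h₁) (ConcreteCategory.hom_ext _ _ fun _ => h₂))
    PUnit.unit

/-- A power set classifies subsets. -/
lemma existsUnique_of_isPowerObject {M A P : Type u} {a : M ⟶ A} {p : M ⟶ P} (h : IsPowerObject a p)
    (W : A → Prop) : ∃! q : P, ∀ x, W x ↔ ∃ m, a m = x ∧ p m = q := by
  obtain ⟨χ, ⟨t, ht, hp⟩, huniq⟩ := h.existsUnique_classifying
    (R := { x // W x }) (B := PUnit.{u + 1}) (↾Subtype.val) (↾fun _ => PUnit.unit)
    (fun Z f g e _ => ConcreteCategory.hom_ext _ _ fun z =>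
      Subtype.ext (ConcreteCategory.congr_hom e z))
  have ht' : ∀ x, a (t x) = x.1 := fun x => ConcreteCategory.congr_hom ht x
  rw [Types.isPullback_iff] at hp
  refine ⟨χ PUnit.unit, fun x => ⟨fun hx => ⟨t ⟨x, hx⟩, ht' _,
    ConcreteCategory.congr_hom hp.1 _⟩, ?_⟩, fun q hq => ?_⟩
  · rintro ⟨m, rfl, hm⟩
    obtain ⟨z, rfl, -⟩ := hp.2.2 m PUnit.unit hm
    rw [ht']
    exact z.2
  · choose t' ht₁ ht₂ using fun x : { x // W x } => (hq x.1).1 x.2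
    refine ConcreteCategory.congr_hom (huniq (↾fun _ => q) ⟨↾t',
      ConcreteCategory.hom_ext _ _ ht₁, ?_⟩) PUnit.unit
    rw [Types.isPullback_iff]
    refine ⟨ConcreteCategory.hom_ext _ _ ht₂, fun x y e => Subtype.ext ?_, fun m b e => ?_⟩
    · have e₁ : t' x = t' y := e.1
      rw [← ht₁ x, ← ht₁ y, e₁]
    · have hm : W (a m) := (hq _).2 ⟨m, rfl, e⟩
      exact ⟨⟨a m, hm⟩, eq_of_isRelation h.isRelation (ht₁ _) ((ht₂ _).trans e.symm), rfl⟩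

namespace OrbitRelation

variable [IsGrothendieckTopos.{u} T] [∀ i, PreservesFiniteLimits (F i)]
  [∀ i, PreservesColimitsOfSize.{u, u} (F i)]

theorem isAtomicTopos (O : OrbitRelation F) (hF : JointlyReflectIsomorphisms F) :
    IsAtomicTopos T where
  preservesFiniteLimits := constInv_preservesFiniteLimits T
  map_powerObject := by
    intro M A P a p h
    change IsPowerObject ((constInv T).map a) ((constInv T).map p)
    have inj : ∀ {X : Type u} (i : I) {x y : X}, pt F i x = pt F i y → x = y :=
      fun {X} i x y e => (pt_bijective i X).1 e
    refine ⟨(isRelation_iff hF).2 fun i x y h₁ h₂ => ?_, fun R B r s hrs => ?_⟩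
    · obtain ⟨x, rfl⟩ := (pt_bijective i M).2 x
      obtain ⟨y, rfl⟩ := (pt_bijective i M).2 y
      rw [map_pt, map_pt] at h₁ h₂
      rw [eq_of_isRelation h.isRelation (inj i h₁) (inj i h₂)]
    · let W : (Σ i, (F i).obj B) → A → Prop := fun b x =>
        ∃ z, (F b.1).map r z = pt F b.1 x ∧ (F b.1).map s z = b.2
      choose χ hχ hχ' using fun b => existsUnique_of_isPowerObject h (W b)
      have hW : ∀ b b' x, O.rel B b b' → W b x → W b' x := by
        rintro ⟨i, b⟩ ⟨j, b'⟩ x hb hx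
        obtain ⟨z, hz, rfl⟩ : ∃ z : (F i).obj R, (F i).map r z = pt F i x ∧
          (F i).map s z = b := hx
        obtain ⟨z', hz', hzz⟩ := O.lift s (p := ⟨i, z⟩) hb
        refine ⟨z', ?_, hz'⟩
        have := O.map r hzz
        obtain ⟨y, hy⟩ := (pt_bijective j A).2 ((F j).map r z')
        dsimp only at this
        rw [hz, ← hy] at this
        exact hy.symm.trans (congrArg _ (O.eq_of_rel_pt this).symm)
      have hχr : ∀ b b', O.rel B b b' → χ b = χ b' := fun b b' hb => hχ' b' _ fun x =>
        ⟨fun hx => (hχ b x).1 (hW b' b x (O.symm hb) hx),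
          fun hx => hW b b' x hb ((hχ b x).2 hx)⟩
      obtain ⟨c, hc⟩ := O.exists_hom_const hF χ hχr
      have hτ : ∀ z : (Σ i, (F i).obj R), ∃ m, pt F z.1 (a m) = (F z.1).map r z.2 ∧
          p m = χ ⟨z.1, (F z.1).map s z.2⟩ := by
        rintro ⟨i, z⟩
        obtain ⟨x, hx⟩ := (pt_bijective i A).2 ((F i).map r z)
        obtain ⟨m, rfl, hm⟩ := (hχ ⟨i, (F i).map s z⟩ x).1 ⟨z, hx.symm, rfl⟩
        exact ⟨m, hx, hm⟩
      choose τ hτ₁ hτ₂ using hτ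
      obtain ⟨t, ht⟩ := O.exists_hom_const hF τ (fun z z' hz => by
        refine eq_of_isRelation h.isRelation ?_ ?_
        · have := O.map r hz
          rw [← hτ₁ z, ← hτ₁ z'] at this
          exact O.eq_of_rel_pt this
        · rw [hτ₂, hτ₂]
          exact hχr _ _ (O.map s hz))
      refine ⟨c, ⟨t, hom_ext hF fun i z => ?_, (isPullback_iff hF).2 fun i =>
        ⟨fun z => ?_, fun z z' h₁ h₂ => ?_, fun m b hmb => ?_⟩⟩, fun c' hc' => ?_⟩
      · rw [map_comp_apply, ht, map_pt]
        exact hτ₁ ⟨i, z⟩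
      · rw [ht, map_pt, hc]
        exact congrArg _ (hτ₂ ⟨i, z⟩)
      · rw [ht, ht] at h₁
        refine (isRelation_iff hF).1 hrs i _ _ ?_ h₂
        rw [← hτ₁ ⟨i, z⟩, ← hτ₁ ⟨i, z'⟩, inj i h₁]
      · obtain ⟨m, rfl⟩ := (pt_bijective i M).2 m
        rw [map_pt, hc] at hmb
        obtain ⟨z, hz, rfl⟩ : ∃ z : (F i).obj R, (F i).map r z = pt F i (a m) ∧
          (F i).map s z = b := (hχ ⟨i, b⟩ (a m)).2 ⟨m, rfl, inj i hmb⟩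
        refine ⟨z, (ht i z).trans (congrArg _ ?_), rfl⟩
        refine eq_of_isRelation h.isRelation (inj i ((hτ₁ ⟨i, z⟩).trans hz)) ?_
        exact (hτ₂ ⟨i, z⟩).trans (inj i hmb).symm
      · obtain ⟨t', ht', hp'⟩ := hc'
        have hp := (isPullback_iff hF).1 hp'
        refine hom_ext hF fun i b => ?_
        obtain ⟨q, hq⟩ := (pt_bijective i P).2 ((F i).map c' b)
        rw [hc, ← hq]
        refine congrArg _ (hχ' ⟨i, b⟩ q fun x => ⟨?_, ?_⟩)
        · intro hx
          obtain ⟨z, hz, rfl⟩ : ∃ z : (F i).obj R, (F i).map r z = pt F i x ∧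
            (F i).map s z = b := hx
          obtain ⟨m, hm⟩ := (pt_bijective i M).2 ((F i).map t' z)
          refine ⟨m, inj i ?_, inj i ?_⟩
          · rw [← hz, ← ht', map_comp_apply, ← hm, map_pt]
          · have := (hp i).1 z
            rw [← hm, map_pt] at this
            exact this.trans hq.symm
        · rintro ⟨m, rfl, rfl⟩
          obtain ⟨z, hz, rfl⟩ := (hp i).2.2 (pt F i m) b ((map_pt i p m).trans hq)
          refine ⟨z, ?_, rfl⟩
          rw [← ht', map_comp_apply, hz, map_pt]

/-- The functor of connected components. -/
def components (O : OrbitRelation F) : T ⥤ Type u where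
  obj A := Quot (O.rel A)
  map g := ↾Quot.map (fun p => ⟨p.1, (F p.1).map g p.2⟩) fun _ _ h => O.map g h
  map_id A := ConcreteCategory.hom_ext _ _ fun x => by
    obtain ⟨⟨i, x⟩, rfl⟩ := Quot.exists_rep x
    exact congrArg (fun y => Quot.mk _ (⟨i, y⟩ : Σ i, (F i).obj A))
      (ConcreteCategory.congr_hom ((F i).map_id A) x)
  map_comp {A B C} f g := ConcreteCategory.hom_ext _ _ fun x => by
    obtain ⟨⟨i, x⟩, rfl⟩ := Quot.exists_rep x
    exact congrArg (fun y => Quot.mk _ (⟨i, y⟩ : Σ i, (F i).obj C)) (map_comp_apply i f g x)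

/-- The arrow to a constant object given by a function on the components. -/
def homConst (O : OrbitRelation F) (hF : JointlyReflectIsomorphisms F) {A : T} {P : Type u}
    (φ : O.components.obj A ⟶ P) : A ⟶ (constInv T).obj P :=
  (O.exists_hom_const hF (fun p => φ (Quot.mk _ p))
    fun _ _ h => congrArg φ (Quot.sound h)).choose

lemma map_homConst (O : OrbitRelation F) (hF : JointlyReflectIsomorphisms F) {A : T} {P : Type u}
    (φ : O.components.obj A ⟶ P) (i : I) (x : (F i).obj A) :
    (F i).map (O.homConst hF φ) x = pt F i (φ (Quot.mk _ ⟨i, x⟩)) :=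
  (O.exists_hom_const hF (fun p => φ (Quot.mk _ p))
    fun _ _ h => congrArg φ (Quot.sound h)).choose_spec i x

/-- Arrows to a constant object are functions on the components. -/
def componentsEquiv (O : OrbitRelation F) (hF : JointlyReflectIsomorphisms F) (A : T)
    (P : Type u) : (O.components.obj A ⟶ P) ≃ (A ⟶ (constInv T).obj P) where
  toFun φ := O.homConst hF φ
  invFun g := ↾Quot.lift (fun p => (ptEquiv F p.1 P).symm ((F p.1).map g p.2))
    fun _ _ h => O.symm_eq_of_rel (O.map g h)
  left_inv φ := ConcreteCategory.hom_ext _ _ fun x => by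
    obtain ⟨⟨i, x⟩, rfl⟩ := Quot.exists_rep x
    exact (ptEquiv F i P).symm_apply_eq.2 (O.map_homConst hF φ i x)
  right_inv g := hom_ext hF fun i x =>
    (O.map_homConst hF _ i x).trans ((ptEquiv F i P).apply_symm_apply _)

lemma pt_componentsEquiv_symm (O : OrbitRelation F) (hF : JointlyReflectIsomorphisms F) {A : T}
    {P : Type u} (g : A ⟶ (constInv T).obj P) (i : I) (x : (F i).obj A) :
    pt F i ((O.componentsEquiv hF A P).symm g (Quot.mk _ ⟨i, x⟩)) = (F i).map g x :=
  (ptEquiv F i P).apply_symm_apply _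

/-- The functor of connected components is left adjoint to the constant object functor. -/
def componentsAdj (O : OrbitRelation F) (hF : JointlyReflectIsomorphisms F) :
    O.components ⊣ constInv T :=
  Adjunction.mkOfHomEquiv
    { homEquiv := O.componentsEquiv hF
      homEquiv_naturality_left_symm := fun f g => ConcreteCategory.hom_ext _ _ fun x => by
        obtain ⟨⟨i, x⟩, rfl⟩ := Quot.exists_rep x
        apply (pt_bijective (F := F) i _).1
        rw [pt_componentsEquiv_symm, map_comp_apply]
        exact (O.pt_componentsEquiv_symm hF g i _).symm
      homEquiv_naturality_right := fun f g => by
        refine ((Equiv.symm_apply_eq (O.componentsEquiv hF _ _)).1 ?_).symm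
        refine ConcreteCategory.hom_ext _ _ fun x => ?_
        obtain ⟨⟨i, x⟩, rfl⟩ := Quot.exists_rep x
        apply (pt_bijective (F := F) i _).1
        rw [pt_componentsEquiv_symm, map_comp_apply]
        exact (congrArg _ (O.map_homConst hF f i x)).trans (map_pt i g _) }

lemma pt_componentsAdj_symm (O : OrbitRelation F) (hF : JointlyReflectIsomorphisms F) {A : T}
    {P : Type u} (g : A ⟶ (constInv T).obj P) (p : Σ i, (F i).obj A) :
    pt F p.1 (((O.componentsAdj hF).homEquiv A P).symm g (Quot.mk _ p)) = (F p.1).map g p.2 := by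
  rw [componentsAdj, Adjunction.mkOfHomEquiv_homEquiv]
  exact O.pt_componentsEquiv_symm hF g p.1 p.2

lemma exists_lift_of_eqvGen (O : OrbitRelation F) {A B : T} (g : A ⟶ B)
    {b b' : Σ i, (F i).obj B} (h : Relation.EqvGen (O.rel B) b b') (p : (F b.1).obj A)
    (hp : (F b.1).map g p = b.2) : ∃ q : (F b'.1).obj A, (F b'.1).map g q = b'.2 ∧
      Quot.mk (O.rel A) ⟨b.1, p⟩ = Quot.mk (O.rel A) ⟨b'.1, q⟩ := by
  suffices H : ((∀ p : (F b.1).obj A, (F b.1).map g p = b.2 → ∃ q : (F b'.1).obj A,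
      (F b'.1).map g q = b'.2 ∧ Quot.mk (O.rel A) ⟨b.1, p⟩ = Quot.mk (O.rel A) ⟨b'.1, q⟩) ∧
      (∀ q : (F b'.1).obj A, (F b'.1).map g q = b'.2 → ∃ p : (F b.1).obj A,
      (F b.1).map g p = b.2 ∧ Quot.mk (O.rel A) ⟨b.1, p⟩ = Quot.mk (O.rel A) ⟨b'.1, q⟩)) from
    H.1 p hp
  clear p hp
  induction h with
  | rel x y h =>
    constructor
    · intro p hp
      obtain ⟨q, hq, hpq⟩ := O.lift g (p := ⟨x.1, p⟩) (q := y) (by dsimp only; rwa [hp])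
      exact ⟨q, hq, Quot.sound hpq⟩
    · intro p hp
      obtain ⟨q, hq, hpq⟩ := O.lift g (p := ⟨y.1, p⟩) (q := x)
        (by dsimp only; rw [hp]; exact O.symm h)
      exact ⟨q, hq, (Quot.sound hpq).symm⟩
  | refl x => exact ⟨fun p hp => ⟨p, hp, rfl⟩, fun p hp => ⟨p, hp, rfl⟩⟩
  | symm x y _ ih =>
    refine ⟨fun p hp => ?_, fun p hp => ?_⟩
    · obtain ⟨q, h₁, h₂⟩ := ih.2 p hp
      exact ⟨q, h₁, h₂.symm⟩
    · obtain ⟨q, h₁, h₂⟩ := ih.1 p hp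
      exact ⟨q, h₁, h₂.symm⟩
  | trans x y z _ _ ih₁ ih₂ =>
    refine ⟨fun p hp => ?_, fun p hp => ?_⟩
    · obtain ⟨q, h₁, h₂⟩ := ih₁.1 p hp
      obtain ⟨q', h₁', h₂'⟩ := ih₂.1 q h₁
      exact ⟨q', h₁', h₂.trans h₂'⟩
    · obtain ⟨q, h₁, h₂⟩ := ih₂.2 p hp
      obtain ⟨q', h₁', h₂'⟩ := ih₁.2 q h₁
      exact ⟨q', h₁', h₂'.trans h₂⟩

theorem isLocallyConnectedTopos (O : OrbitRelation F) (hF : JointlyReflectIsomorphisms F) :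
    IsLocallyConnectedTopos T := by
  refine ⟨O.components, O.componentsAdj hF, fun A B h X Y x k y hp => ?_⟩
  have hp' := (isPullback_iff hF).1 hp
  have hX : ∀ p, pt F p.1 (((O.componentsAdj hF).homEquiv X B).symm x (Quot.mk _ p)) =
      (F p.1).map x p.2 := O.pt_componentsAdj_symm hF x
  have hY : ∀ p, pt F p.1 (((O.componentsAdj hF).homEquiv Y A).symm y (Quot.mk _ p)) =
      (F p.1).map y p.2 := O.pt_componentsAdj_symm hF y
  rw [Types.isPullback_iff]
  refine ⟨ConcreteCategory.hom_ext _ _ fun p => ?_, fun p p' e => ?_, fun q a e => ?_⟩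
  · obtain ⟨⟨i, p⟩, rfl⟩ := Quot.exists_rep p
    apply (pt_bijective (F := F) i _).1
    refine (hX ⟨i, (F i).map k p⟩).trans ?_
    refine ((hp' i).1 p).trans ?_
    refine (congrArg _ (hY ⟨i, p⟩).symm).trans ?_
    exact map_pt i h _
  · obtain ⟨⟨i, p⟩, rfl⟩ := Quot.exists_rep p
    obtain ⟨⟨j, p'⟩, rfl⟩ := Quot.exists_rep p'
    obtain ⟨e₁, e₂⟩ := e
    obtain ⟨q, hq, hpq⟩ := O.exists_lift_of_eqvGen k (b := ⟨i, (F i).map k p⟩)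
      (b' := ⟨j, (F j).map k p'⟩) (Quot.eqvGen_exact e₁) p rfl
    refine hpq.trans (congrArg (fun z => Quot.mk _ (⟨j, z⟩ : Σ i, (F i).obj Y)) ?_)
    refine (hp' j).2.1 _ _ hq ?_
    refine (hY ⟨j, q⟩).symm.trans (Eq.trans ?_ (hY ⟨j, p'⟩))
    exact congrArg _ ((congrArg _ hpq.symm).trans e₂)
  · obtain ⟨⟨i, q⟩, rfl⟩ := Quot.exists_rep q
    obtain ⟨z, hz, hz'⟩ := (hp' i).2.2 q (pt F i a) ((hX ⟨i, q⟩).symm.trans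
      ((congrArg _ e).trans (map_pt i h a).symm))
    refine ⟨Quot.mk _ ⟨i, z⟩, congrArg (fun z => Quot.mk _ (⟨i, z⟩ : Σ i, (F i).obj X)) hz, ?_⟩
    apply (pt_bijective (F := F) i _).1
    exact (hY ⟨i, z⟩).trans hz'

end OrbitRelation

end FiberFunctors

end

noncomputable section

set_option linter.unusedSectionVars false

variable {E : Type v} [Category.{u} E] [IsGrothendieckTopos.{u} E]

namespace LocConst

variable {𝒰 : Cover.{u} E}

/-! ### Covering projections -/

lemma const_prod_hom_ext {P : Type u} {C Z : E} {g h : (constInv E).obj P ⨯ C ⟶ Z}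
    (H : ∀ x : P, prod.lift (terminal.from C ≫ constPt x) (𝟙 C) ≫ g =
      prod.lift (terminal.from C ≫ constPt x) (𝟙 C) ≫ h) : g = h := by
  obtain ⟨S, hS, hs⟩ := const_local_mem (prod.fst : (constInv E).obj P ⨯ C ⟶ _)
  refine eq_of_mem_epicTopology hS fun D d hd => ?_
  obtain ⟨x, hx⟩ := hs d hd
  have : d = (d ≫ prod.snd) ≫ prod.lift (terminal.from C ≫ constPt x) (𝟙 C) := by
    apply Limits.prod.hom_ext
    · rw [Category.assoc, prod.lift_fst, hx, ← Category.assoc]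
      exact congrArg (· ≫ constPt x) (Subsingleton.elim _ _)
    · rw [Category.assoc, prod.lift_snd, Category.comp_id]
  rw [this]
  exact (Category.assoc _ _ _).trans ((congrArg ((d ≫ prod.snd) ≫ ·) (H x)).trans
    (Category.assoc _ _ _).symm)

/-- The action triples in terms of local sections. -/
lemma isActionTriple_iff (A : LocConst 𝒰) {i j : 𝒰.I} {C : E} (u : C ⟶ 𝒰.U i) (v : C ⟶ 𝒰.U j)
    (s : A.S i ≃ A.S j) : A.IsActionTriple u v s ↔
      IsNonemptyObject C ∧ ∀ x, u ≫ A.sec x = v ≫ A.sec (s x) := by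
  have key : ∀ x, prod.lift (terminal.from C ≫ constPt x) (𝟙 C) ≫
      prod.lift (prod.map (𝟙 ((constInv E).obj (A.S i))) u) (prod.snd ≫ v) ≫ A.σ i j =
      prod.lift (terminal.from C ≫ constPt x) (𝟙 C) ≫ prod.map ((constInv E).map (↾s)) (𝟙 C) ≫
        prod.lift (prod.map (𝟙 ((constInv E).obj (A.S j))) v) (prod.snd ≫ u) ↔
      u ≫ A.sec x = v ≫ A.sec (s x) := by
    intro x
    have h₁ : prod.lift (terminal.from C ≫ constPt x) (𝟙 C) ≫
        prod.lift (prod.map (𝟙 ((constInv E).obj (A.S i))) u) (prod.snd ≫ v) ≫ A.σ i j =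
        prod.lift (prod.lift (u ≫ A.sec x) v ≫ (A.θ j).inv) u := by
      have e₁ : prod.lift (terminal.from C ≫ constPt x) (𝟙 C) ≫
        prod.lift (prod.map (𝟙 ((constInv E).obj (A.S i))) u) (prod.snd ≫ v) ≫
          prod.map (A.θ i).hom (𝟙 (𝒰.U j)) = prod.lift (prod.lift (u ≫ A.sec x) u) v := by
        apply Limits.prod.hom_ext
        · simp [prod.lift_fst, lift_θ]
        · simp [prod.lift_snd, prod.lift_snd_assoc]
      have e₂ : prod.lift (prod.lift (u ≫ A.sec x) u) v ≫
          prod.lift (prod.map prod.fst (𝟙 (𝒰.U j))) (prod.fst ≫ prod.snd) =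
            prod.lift (prod.lift (u ≫ A.sec x) v) u := by
        apply Limits.prod.hom_ext
        · simp [prod.lift_fst]
        · simp [prod.lift_snd, prod.lift_fst_assoc]
      unfold σ
      rw [← Category.assoc (prod.lift (prod.map _ _) _), ← Category.assoc, e₁, ← Category.assoc,
        e₂]
      simp
    have h₂ : prod.lift (terminal.from C ≫ constPt x) (𝟙 C) ≫
        prod.map ((constInv E).map (↾s)) (𝟙 C) ≫
        prod.lift (prod.map (𝟙 ((constInv E).obj (A.S j))) v) (prod.snd ≫ u) =
        prod.lift (prod.lift (terminal.from C ≫ constPt (s x)) v) u := by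
      have : constPt x ≫ (constInv E).map (↾s) = constPt (E := E) (s x) := constPt_map (↾s) x
      apply Limits.prod.hom_ext
      · simp [prod.lift_fst, this]
      · simp [prod.lift_snd, prod.lift_snd_assoc]
    rw [h₁, h₂]
    constructor
    · intro h
      have h' := congrArg (fun t => (t ≫ prod.fst) ≫ (A.θ j).hom ≫ prod.fst) h
      simp only [prod.lift_fst, Category.assoc, Iso.inv_hom_id_assoc] at h'
      rw [← Category.assoc, lift_θ, prod.lift_fst] at h'
      exact h'
    · intro h
      rw [h, ← lift_θ, Category.assoc, Iso.hom_inv_id, Category.comp_id]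
  constructor
  · exact fun h => ⟨h.nonempty, fun x => (key x).1 (congrArg _ h.comm)⟩
  · exact fun h => ⟨h.1, const_prod_hom_ext fun x => (key x).2 (h.2 x)⟩

/-- The sieve of the arrows over which the fibres at `i` and `j` are identified. -/
def splitSieve (A : LocConst 𝒰) (i j : 𝒰.I) : Sieve (𝒰.U i ⨯ 𝒰.U j) where
  arrows C f := (∀ x : A.S i, ∃ y : A.S j, (f ≫ prod.fst) ≫ A.sec x = (f ≫ prod.snd) ≫ A.sec y) ∧
    ∀ y : A.S j, ∃ x : A.S i, (f ≫ prod.snd) ≫ A.sec y = (f ≫ prod.fst) ≫ A.sec x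
  downward_closed := by
    rintro C D f ⟨h₁, h₂⟩ g
    constructor
    · intro x
      obtain ⟨y, h⟩ := h₁ x
      exact ⟨y, by simpa using congrArg (g ≫ ·) h⟩
    · intro x
      obtain ⟨y, h⟩ := h₂ x
      exact ⟨y, by simpa using congrArg (g ≫ ·) h⟩

lemma isCoveringProjection_iff (A : LocConst 𝒰) :
    A.IsCoveringProjection ↔ ∀ i j, A.splitSieve i j ∈ epicTopology E (𝒰.U i ⨯ 𝒰.U j) := by
  constructor
  · intro h i j
    by_cases hU : IsNonemptyObject (𝒰.U i ⨯ 𝒰.U j)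
    · refine (epicTopology E).superset_covering ?_
        ((ofArrows_mem_epicTopology_iff _ _).2 (h i j hU))
      rw [Sieve.ofArrows, Sieve.generate_le_iff]
      rintro C _ ⟨t⟩
      have ht := ((A.isActionTriple_iff _ _ _).1 t.isActionTriple).2
      refine ⟨fun x => ⟨t.s x, ?_⟩, fun y => ⟨t.s.symm y, ?_⟩⟩
      · rw [prod.lift_fst, prod.lift_snd, ht]
      · rw [prod.lift_fst, prod.lift_snd, ht, Equiv.apply_symm_apply]
    · exact mem_epicTopology_of_not_isNonemptyObject hU _
  · intro h i j _
    refine (ofArrows_mem_epicTopology_iff _ _).1 (mem_epicTopology_of_le (h i j) ?_)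
    rintro D d ⟨h₁, h₂⟩ hD
    choose s hs using h₁
    have hs' : Function.Bijective s := by
      refine ⟨fun x x' e => A.sec_injective hD (u := d ≫ prod.fst) ?_, fun y => ?_⟩
      · rw [hs, hs, e]
      · obtain ⟨x, hx⟩ := h₂ y
        exact ⟨x, A.sec_injective hD ((hs x).symm.trans hx.symm)⟩
    let t : A.ActionTriple i j := ⟨D, d ≫ prod.fst, d ≫ prod.snd, Equiv.ofBijective s hs',
      (A.isActionTriple_iff _ _ _).2 ⟨hD, hs⟩⟩
    have hd : d = prod.lift (d ≫ prod.fst) (d ≫ prod.snd) := by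
      apply Limits.prod.hom_ext
      · rw [prod.lift_fst]
      · rw [prod.lift_snd]
    rw [hd]
    exact Sieve.le_generate _ _ _ (Presieve.ofArrows.mk (f := fun t : A.ActionTriple i j =>
      prod.lift t.u t.v) t)

lemma exists_sec_eq {Q B₁ B₂ : LocConst 𝒰} (g₁ : Q ⟶ B₁) (g₂ : Q ⟶ B₂) {i j : 𝒰.I}
    (hg : ∀ (x y : Q.S j), g₁.ϑ j x = g₁.ϑ j y → g₂.ϑ j x = g₂.ϑ j y → x = y) {C : E}
    (hC : IsNonemptyObject C) {u : C ⟶ 𝒰.U i} {v : C ⟶ 𝒰.U j} {x : Q.S i}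
    (h₁ : ∃ y, u ≫ B₁.sec (g₁.ϑ i x) = v ≫ B₁.sec y)
    (h₂ : ∃ y, u ≫ B₂.sec (g₂.ϑ i x) = v ≫ B₂.sec y) :
    ∃ y, u ≫ Q.sec x = v ≫ Q.sec y := by
  obtain ⟨y₁, h₁⟩ := h₁
  obtain ⟨y₂, h₂⟩ := h₂
  obtain ⟨S, hS, hs⟩ := Q.sec_cover (u ≫ Q.sec x) v
  have val : ∀ {B : LocConst 𝒰} (g : Q ⟶ B) (z : B.S j), u ≫ B.sec (g.ϑ i x) = v ≫ B.sec z →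
      ∀ ⦃D : E⦄ (d : D ⟶ C), IsNonemptyObject D → ∀ y, d ≫ u ≫ Q.sec x = (d ≫ v) ≫ Q.sec y →
        g.ϑ j y = z := by
    intro B g z hz D d hD y hy
    refine B.sec_injective hD (u := d ≫ v) ?_
    rw [← sec_map, ← Category.assoc, ← hy, Category.assoc, Category.assoc, sec_map, hz,
      Category.assoc]
  obtain ⟨D, d, hd, hD⟩ := hC.exists_of_mem hS
  obtain ⟨y, hy⟩ := hs d hd
  refine ⟨y, eq_of_mem_epicTopology hS fun D' d' hd' => ?_⟩
  by_cases hD' : IsNonemptyObject D'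
  · obtain ⟨y', hy'⟩ := hs d' hd'
    have : y' = y := hg _ _
      ((val g₁ y₁ h₁ d' hD' y' hy').trans (val g₁ y₁ h₁ d hD y hy).symm)
      ((val g₂ y₂ h₂ d' hD' y' hy').trans (val g₂ y₂ h₂ d hD y hy).symm)
    rw [hy', this, Category.assoc]
  · exact eq_of_mem_epicTopology (mem_epicTopology_of_not_isNonemptyObject hD' ⊥)
      fun _ _ h => h.elim

lemma IsCoveringProjection.of_jointly_injective {Q B₁ B₂ : LocConst 𝒰}
    (hB₁ : B₁.IsCoveringProjection) (hB₂ : B₂.IsCoveringProjection) (g₁ : Q ⟶ B₁) (g₂ : Q ⟶ B₂)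
    (hg : ∀ i (x y : Q.S i), g₁.ϑ i x = g₁.ϑ i y → g₂.ϑ i x = g₂.ϑ i y → x = y) :
    Q.IsCoveringProjection := by
  rw [isCoveringProjection_iff] at *
  intro i j
  refine mem_epicTopology_of_le ((epicTopology E).intersection_covering (hB₁ i j) (hB₂ i j)) ?_
  rintro D d ⟨h₁, h₂⟩ hD
  exact ⟨fun x => exists_sec_eq g₁ g₂ (hg j) hD (h₁.1 _) (h₂.1 _),
    fun x => exists_sec_eq g₁ g₂ (hg i) hD (h₁.2 _) (h₂.2 _)⟩

lemma IsCoveringProjection.of_image {M A B : LocConst 𝒰} (hB : B.IsCoveringProjection)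
    (g : B ⟶ A) (m : M ⟶ A) (hm : ∀ i, Function.Injective (m.ϑ i))
    (h : ∀ i x, ∃ y, g.ϑ i y = m.ϑ i x) : M.IsCoveringProjection := by
  rw [isCoveringProjection_iff] at *
  have key : ∀ {i j : 𝒰.I} {D : E} (_ : IsNonemptyObject D) {u : D ⟶ 𝒰.U i} {v : D ⟶ 𝒰.U j}
      (_ : ∀ y : B.S i, ∃ z : B.S j, u ≫ B.sec y = v ≫ B.sec z) (x : M.S i),
      ∃ x' : M.S j, u ≫ M.sec x = v ≫ M.sec x' := by
    intro i j D hD u v H x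
    obtain ⟨y, hy⟩ := h i x
    obtain ⟨z, hz⟩ := H y
    have e : u ≫ A.sec (m.ϑ i x) = v ≫ A.sec (g.ϑ j z) := by
      rw [← hy, ← sec_map, ← Category.assoc, hz, Category.assoc, sec_map]
    obtain ⟨x', hx', -⟩ := Rel.lift m (x := x) (y := g.ϑ j z) ⟨D, u, v, hD, e⟩
    exact ⟨x', sec_eq_of_map m (hm j) (by rw [e, hx'])⟩
  intro i j
  refine mem_epicTopology_of_le (hB i j) ?_
  rintro D d ⟨h₁, h₂⟩ hD
  exact ⟨key hD h₁, key hD h₂⟩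

lemma isCoveringProjection_const (P : Type u) : (const 𝒰 P).IsCoveringProjection := by
  rw [isCoveringProjection_iff]
  intro i j
  refine mem_epicTopology_of_le ((epicTopology E).top_mem _) fun D d _ _ => ?_
  exact ⟨fun x => ⟨x, (comp_sec_const _ _).trans (comp_sec_const _ _).symm⟩,
    fun x => ⟨x, (comp_sec_const _ _).trans (comp_sec_const _ _).symm⟩⟩

/-! ### Sums of covering projections -/

lemma image_iff_of_rel {A B : LocConst 𝒰} (g : B ⟶ A) {p q : Σ i, A.S i} (h : A.Rel p q) :
    (∃ y, g.ϑ p.1 y = p.2) ↔ ∃ y, g.ϑ q.1 y = q.2 := by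
  have : ∀ {p q : Σ i, A.S i}, A.Rel p q → (∃ y, g.ϑ p.1 y = p.2) → ∃ y, g.ϑ q.1 y = q.2 := by
    rintro ⟨i, x⟩ ⟨j, y⟩ h hx
    obtain ⟨x, rfl⟩ : ∃ x', g.ϑ i x' = x := hx
    obtain ⟨y', hy', -⟩ := Rel.lift g h
    exact ⟨y', hy'⟩
  exact ⟨this h, this h.symm⟩

lemma image_iff_of_quot_eq {A B : LocConst 𝒰} (g : B ⟶ A) {p q : Σ i, A.S i}
    (h : Quot.mk A.Rel p = Quot.mk A.Rel q) :
    (∃ y, g.ϑ p.1 y = p.2) ↔ ∃ y, g.ϑ q.1 y = q.2 :=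
  iff_of_eq (congrArg (Quot.lift (fun p : Σ i, A.S i => ∃ y, g.ϑ p.1 y = p.2)
    fun _ _ h => propext (image_iff_of_rel g h)) h)

/-- The sums of covering projections are the objects covered by covering projections. -/
lemma isSumOfCoveringProjections_iff (A : LocConst 𝒰) : isSumOfCoveringProjections 𝒰 A ↔
    ∀ i (x : A.S i), ∃ (B : LocConst 𝒰) (g : B ⟶ A) (y : B.S i),
      B.IsCoveringProjection ∧ g.ϑ i y = x := by
  constructor
  · rintro ⟨K, B, b, hB, ⟨hc⟩⟩ i x
    obtain ⟨⟨k⟩, y, hy⟩ := Types.jointly_surjective_of_isColimit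
      (isColimitOfPreserves (fiber 𝒰 i) hc) x
    exact ⟨B k, b k, y, hB k, hy⟩
  · intro h
    choose M m hm using fun k : Quot A.Rel => A.exists_sub (fun p => Quot.mk _ p = k)
      fun p q h hp => (Quot.sound h).symm.trans hp
    refine ⟨Quot A.Rel, M, m, fun k => ?_, ?_⟩
    · obtain ⟨⟨i, x⟩, rfl⟩ := Quot.exists_rep k
      obtain ⟨B, g, y, hB, rfl⟩ := h i x
      refine hB.of_image g _ (fun j => (hm _ j).1) fun j z => ?_
      exact (image_iff_of_quot_eq g (((hm _ j).2 _).2 ⟨z, rfl⟩)).2 ⟨y, rfl⟩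
    · refine FiberFunctors.isColimit_cofan (jointlyReflectIsomorphisms_fiber 𝒰) m
        (fun i x => ⟨Quot.mk _ ⟨i, x⟩, ((hm _ i).2 x).1 rfl⟩) (fun i k l x y e => ?_)
        fun i k => (hm k i).1
      exact (((hm k i).2 _).2 ⟨x, rfl⟩).symm.trans (((hm l i).2 _).2 ⟨y, e.symm⟩)

lemma exists_pullback_fiber {A B X P : LocConst 𝒰} {a : P ⟶ A} {b : P ⟶ B} {f : A ⟶ X} {g : B ⟶ X}
    (h : IsPullback a b f g) (i : 𝒰.I) :
    (∀ z z', a.ϑ i z = a.ϑ i z' → b.ϑ i z = b.ϑ i z' → z = z') ∧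
      ∀ x y, f.ϑ i x = g.ϑ i y → ∃ z, a.ϑ i z = x ∧ b.ϑ i z = y := by
  obtain ⟨-, h₂, h₃⟩ := (Types.isPullback_iff _ _ _ _).1 (h.map (fiber 𝒰 i))
  exact ⟨fun z z' e e' => h₂ z z' ⟨e, e'⟩, h₃⟩

lemma isSumOfCoveringProjections_of_isPullback {A B X P : LocConst 𝒰} {a : P ⟶ A} {b : P ⟶ B}
    {f : A ⟶ X} {g : B ⟶ X} (h : IsPullback a b f g) (hA : isSumOfCoveringProjections 𝒰 A)
    (hB : isSumOfCoveringProjections 𝒰 B) : isSumOfCoveringProjections 𝒰 P := by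
  rw [isSumOfCoveringProjections_iff] at *
  intro i z
  obtain ⟨A', a', x, hA', hx⟩ := hA i (a.ϑ i z)
  obtain ⟨B', b', y, hB', hy⟩ := hB i (b.ϑ i z)
  have hP := IsPullback.of_hasPullback (a' ≫ f) (b' ≫ g)
  have e : f.ϑ i (a.ϑ i z) = g.ϑ i (b.ϑ i z) :=
    ConcreteCategory.congr_hom (congrArg (fun t => Hom.ϑ t i) h.w) z
  obtain ⟨w, hw, hw'⟩ := (exists_pullback_fiber hP i).2 x y
    ((congrArg (f.ϑ i) hx).trans (e.trans (congrArg (g.ϑ i) hy).symm))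
  let l := h.lift (pullback.fst (a' ≫ f) (b' ≫ g) ≫ a') (pullback.snd (a' ≫ f) (b' ≫ g) ≫ b')
    (by simpa using hP.w)
  refine ⟨_, l, w, hA'.of_jointly_injective hB' _ _ fun i => (exists_pullback_fiber hP i).1,
    (exists_pullback_fiber h i).1 _ _ ?_ ?_⟩
  · refine (ConcreteCategory.congr_hom (congrArg (fun t => Hom.ϑ t i) (h.lift_fst _ _ _)) w).trans ?_
    exact (congrArg (a'.ϑ i) hw).trans hx
  · refine (ConcreteCategory.congr_hom (congrArg (fun t => Hom.ϑ t i) (h.lift_snd _ _ _)) w).trans ?_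
    exact (congrArg (b'.ϑ i) hw').trans hy

lemma isSumOfCoveringProjections_of_injective {A M : LocConst 𝒰} (m : M ⟶ A)
    (hm : ∀ i, Function.Injective (m.ϑ i)) (hA : isSumOfCoveringProjections 𝒰 A) :
    isSumOfCoveringProjections 𝒰 M := by
  rw [isSumOfCoveringProjections_iff] at *
  intro i x
  obtain ⟨B, g, y, hB, hy⟩ := hA i (m.ϑ i x)
  have hP := IsPullback.of_hasPullback m g
  obtain ⟨w, hw, -⟩ := (exists_pullback_fiber hP i).2 x y hy.symm
  refine ⟨_, pullback.fst m g, w, hB.of_jointly_injective hB (pullback.snd m g) (pullback.snd m g)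
    fun j z z' e _ => (exists_pullback_fiber hP j).1 z z' (hm j ?_) e, hw⟩
  have e' : ∀ z, m.ϑ j ((pullback.fst m g).ϑ j z) = g.ϑ j ((pullback.snd m g).ϑ j z) := fun z =>
    ConcreteCategory.congr_hom (congrArg (fun t => Hom.ϑ t j) hP.w) z
  rw [e', e', e]

instance {J : Type u} [SmallCategory J] :
    (isSumOfCoveringProjections 𝒰).IsClosedUnderColimitsOfShape J where
  colimitsOfShape_le := by
    rintro A ⟨h⟩
    rw [isSumOfCoveringProjections_iff]
    intro i x
    obtain ⟨j, y, rfl⟩ := Types.jointly_surjective_of_isColimit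
      (isColimitOfPreserves (fiber 𝒰 i) h.isColimit) x
    obtain ⟨B, g, z, hB, rfl⟩ := (isSumOfCoveringProjections_iff _).1 (h.prop_diag_obj j) i y
    exact ⟨B, g ≫ h.ι.app j, z, hB, rfl⟩

instance : (isSumOfCoveringProjections 𝒰).IsClosedUnderLimitsOfShape WalkingCospan where
  limitsOfShape_le := by
    rintro A ⟨h⟩
    exact isSumOfCoveringProjections_of_isPullback (IsPullback.of_isLimit_cone h.isLimit)
      (h.prop_diag_obj _) (h.prop_diag_obj _)

instance : (isSumOfCoveringProjections 𝒰).IsClosedUnderLimitsOfShape (Discrete PEmpty.{1}) where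
  limitsOfShape_le := by
    rintro A ⟨h⟩
    rw [isSumOfCoveringProjections_iff]
    intro i x
    let l : const 𝒰 PUnit.{u + 1} ⟶ A := h.isLimit.lift
      { pt := const 𝒰 PUnit.{u + 1}
        π := { app := fun a => a.as.elim, naturality := fun a => a.as.elim } }
    have e : (constPUnitIsTerminal 𝒰).from A ≫ l = 𝟙 A := h.isLimit.hom_ext fun a => a.as.elim
    exact ⟨_, l, ((constPUnitIsTerminal 𝒰).from A).ϑ i x, isCoveringProjection_const _,
      ConcreteCategory.congr_hom (congrArg (fun t => Hom.ϑ t i) e) x⟩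

end LocConst

/-! ### The topos of sums of covering projections -/

namespace CoveringTopos

variable (𝒰 : Cover.{u} E)

instance : HasColimitsOfSize.{u, u} (CoveringTopos 𝒰) where
  has_colimits_of_shape _ _ := inferInstance

instance : PreservesColimitsOfSize.{u, u} (incl 𝒰) where
  preservesColimitsOfShape := inferInstance

instance : HasTerminal (CoveringTopos 𝒰) :=
  hasLimitsOfShape_of_closedUnderLimits (P := isSumOfCoveringProjections 𝒰)
    (J := Discrete PEmpty.{1})

instance : HasFiniteLimits (CoveringTopos 𝒰) :=
  hasFiniteLimits_of_hasTerminal_and_pullbacks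

instance : PreservesFiniteLimits (incl 𝒰) := by
  have : PreservesLimitsOfShape (Discrete PEmpty.{1}) (incl 𝒰) := inferInstance
  have : PreservesLimitsOfShape WalkingCospan (incl 𝒰) := inferInstance
  exact preservesFiniteLimits_of_preservesTerminal_and_pullbacks _

/-- The fibre functors of the topos of sums of covering projections. -/
abbrev fiber (i : 𝒰.I) : CoveringTopos 𝒰 ⥤ Type u := incl 𝒰 ⋙ LocConst.fiber 𝒰 i

lemma jointlyReflectIsomorphisms_fiber : JointlyReflectIsomorphisms (fiber 𝒰) where
  isIso {A B} f h := by
    have : ∀ i, IsIso ((LocConst.fiber 𝒰 i).map ((incl 𝒰).map f)) := h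
    have := (LocConst.jointlyReflectIsomorphisms_fiber 𝒰).isIso ((incl 𝒰).map f)
    exact isIso_of_reflects_iso f (incl 𝒰)

/-- The relation between the points of sums of covering projections. -/
def orbitRelation : FiberFunctors.OrbitRelation (fiber 𝒰) where
  rel A := A.obj.Rel
  symm h := h.symm
  map g _ _ h := LocConst.Rel.map g.hom h
  lift g _ _ h := LocConst.Rel.lift g.hom h
  sub {A} W hW := by
    obtain ⟨M, m, hm⟩ := A.obj.exists_sub W hW
    exact ⟨⟨M, LocConst.isSumOfCoveringProjections_of_injective m (fun i => (hm i).1) A.property⟩,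
      ObjectProperty.homMk m, hm⟩

end CoveringTopos

end

noncomputable section

variable {E : Type v} [Category.{u} E] [IsGrothendieckTopos.{u} E]

namespace LocConst

variable {𝒰 : Cover.{u} E}

/-! ### A small family of locally constant objects which hits all points -/

section Steps

variable {K : Type u} (G : K → E)

variable (𝒰) in
/-- A pair of arrows from a generator to members of the cover. -/
structure Step where
  k : K
  i : 𝒰.I
  j : 𝒰.I
  u : G k ⟶ 𝒰.U i
  v : G k ⟶ 𝒰.U j

variable {G} (A : LocConst 𝒰)

/-- A step moves a point to a point whose section agrees with that of the first one. -/
def Moves (s : Step 𝒰 G) (p q : Σ i, A.S i) : Prop :=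
  ∃ (x : A.S s.i) (y : A.S s.j), p = ⟨s.i, x⟩ ∧ q = ⟨s.j, y⟩ ∧ IsNonemptyObject (G s.k) ∧
    s.u ≫ A.sec x = s.v ≫ A.sec y

variable {A} in
lemma Moves.unique {s : Step 𝒰 G} {p q q' : Σ i, A.S i} (h : A.Moves s p q)
    (h' : A.Moves s p q') : q = q' := by
  obtain ⟨x, y, rfl, rfl, hne, e⟩ := h
  obtain ⟨x', y', hx, rfl, -, e'⟩ := h'
  obtain rfl := eq_of_heq (Sigma.mk.inj hx).2
  rw [A.sec_injective hne (e.symm.trans e')]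

/-- The point `q` is reached from `p₀` by a list of steps. -/
def Reaches (p₀ : Σ i, A.S i) : List (Step 𝒰 G) → (Σ i, A.S i) → Prop
  | [], q => q = p₀
  | s :: l, q => ∃ p, Reaches p₀ l p ∧ A.Moves s p q

variable {A} in
lemma Reaches.unique {p₀ : Σ i, A.S i} {l : List (Step 𝒰 G)} {q q' : Σ i, A.S i}
    (h : A.Reaches p₀ l q) (h' : A.Reaches p₀ l q') : q = q' := by
  induction l generalizing q q' with
  | nil => exact Eq.trans h (Eq.symm h')
  | cons s l ih =>
    obtain ⟨p, hp, hq⟩ := h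
    obtain ⟨p', hp', hq'⟩ := h'
    obtain rfl := ih hp hp'
    exact hq.unique hq'

variable (hG : ∀ X : E, Sieve.ofArrows (fun a : Σ k, G k ⟶ X => G a.1) (fun a => a.2) ∈
  epicTopology E X)

include hG in
lemma Rel.exists_moves {p q : Σ i, A.S i} (h : A.Rel p q) : ∃ s : Step 𝒰 G, A.Moves s p q := by
  obtain ⟨C, u, v, hC, e⟩ := h
  obtain ⟨D, d, hd, hD⟩ := hC.exists_of_mem (hG C)
  obtain ⟨_, a, _, ⟨⟨k, f⟩⟩, -⟩ := hd
  refine ⟨⟨k, p.1, q.1, f ≫ u, f ≫ v⟩, p.2, q.2, rfl, rfl, hD.of_hom a, ?_⟩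
  simpa using congrArg (f ≫ ·) e

include hG in
lemma exists_reaches {p q : Σ i, A.S i} (h : Relation.ReflTransGen A.Rel p q) :
    ∃ l : List (Step 𝒰 G), A.Reaches p l q := by
  induction h with
  | refl => exact ⟨[], rfl⟩
  | tail _ h ih =>
    obtain ⟨l, hl⟩ := ih
    obtain ⟨s, hs⟩ := Rel.exists_moves A hG h
    exact ⟨s :: l, _, hl, hs⟩

include hG in
/-- The orbit of a point: its fibres are bounded in size. -/
lemma exists_orbit {i : 𝒰.I} (x : A.S i) :
    ∃ (M : LocConst 𝒰) (m : M ⟶ A) (y : M.S i), m.ϑ i y = x ∧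
      (∀ j, Function.Injective (m.ϑ j)) ∧
      ∃ e : ∀ j, M.S j → List (Step 𝒰 G), ∀ j, Function.Injective (e j) := by
  obtain ⟨M, m, hm⟩ := A.exists_sub (fun q => Relation.ReflTransGen A.Rel ⟨i, x⟩ q)
    fun p q h hp => hp.tail h
  obtain ⟨y, hy⟩ := ((hm i).2 x).1 Relation.ReflTransGen.refl
  choose e he using fun j (z : M.S j) => A.exists_reaches hG (((hm j).2 (m.ϑ j z)).2 ⟨z, rfl⟩)
  refine ⟨M, m, y, hy, fun j => (hm j).1, e, fun j z z' h => (hm j).1 ?_⟩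
  have h₁ := he j z
  rw [h] at h₁
  exact eq_of_heq (Sigma.mk.inj (h₁.unique (he j z'))).2

/-- Codes for locally constant objects whose fibres are subsets of a given set. -/
structure Code (G : K → E) (Λ : Type u) (𝒰 : Cover.{u} E) where
  W : 𝒰.I → Λ → Prop
  R : Step 𝒰 G → Λ → Λ → Prop

/-- A locally constant object is described by a code. -/
def HasCode {Λ : Type u} (d : Code G Λ 𝒰) : Prop :=
  ∃ e : ∀ i, A.S i → Λ, (∀ i, Function.Injective (e i)) ∧
    (∀ i a, d.W i a ↔ ∃ x, e i x = a) ∧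
    ∀ (s : Step 𝒰 G) x y, s.u ≫ A.sec x = s.v ≫ A.sec y ↔ d.R s (e s.i x) (e s.j y)

lemma exists_hasCode {Λ : Type u} (e : ∀ i, A.S i → Λ) (he : ∀ i, Function.Injective (e i)) :
    ∃ d : Code G Λ 𝒰, A.HasCode d := by
  refine ⟨⟨fun i a => ∃ x, e i x = a, fun s a b => ∃ x y, e s.i x = a ∧ e s.j y = b ∧
    s.u ≫ A.sec x = s.v ≫ A.sec y⟩, e, he, fun _ _ => Iff.rfl, fun s x y => ⟨fun h =>
      ⟨x, y, rfl, rfl, h⟩, ?_⟩⟩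
  rintro ⟨x', y', hx, hy, h⟩
  rwa [← he _ hx, ← he _ hy]

include hG in
lemma HasCode.exists_hom {A B : LocConst 𝒰} {Λ : Type u} {d : Code G Λ 𝒰} (hA : A.HasCode d)
    (hB : B.HasCode d) : ∃ g : A ⟶ B, ∀ i, Function.Bijective (g.ϑ i) := by
  obtain ⟨e, he, he', hA⟩ := hA
  obtain ⟨f, hf, hf', hB⟩ := hB
  choose ϑ hϑ using fun i (x : A.S i) => (hf' i (e i x)).1 ((he' i _).2 ⟨x, rfl⟩)
  obtain ⟨g, hg⟩ := LocConst.exists_hom ϑ (fun i j x y C u v _ h => by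
    refine eq_of_mem_epicTopology (hG C) ?_
    rintro D _ ⟨_, a, _, ⟨⟨k, c⟩⟩, rfl⟩
    have h₁ : (c ≫ u) ≫ A.sec x = (c ≫ v) ≫ A.sec y := by simpa using congrArg (c ≫ ·) h
    have h₂ := (hA ⟨k, i, j, c ≫ u, c ≫ v⟩ x y).1 h₁
    dsimp only at h₂
    rw [← hϑ, ← hϑ] at h₂
    have h₃ := (hB ⟨k, i, j, c ≫ u, c ≫ v⟩ (ϑ i x) (ϑ j y)).2 h₂
    simpa using congrArg (a ≫ ·) h₃)
  refine ⟨g, fun i => ⟨fun x y h => he i ?_, fun y => ?_⟩⟩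
  · rw [← hϑ, ← hϑ, ← hg, ← hg, h]
  · obtain ⟨x, hx⟩ := (he' i (f i y)).1 ((hf' i _).2 ⟨y, rfl⟩)
    exact ⟨x, (hg i x).trans (hf i ((hϑ i x).trans hx))⟩

end Steps

variable (𝒰) in
/-- There is a small family of locally constant objects which hits all points, by arrows which
are injective on fibres. -/
theorem exists_small_hit : ∃ (K : Type u) (G : K → LocConst 𝒰), ∀ (A : LocConst 𝒰) (i : 𝒰.I)
    (x : A.S i), ∃ (k : K) (g : G k ⟶ A) (y : (G k).S i), g.ϑ i y = x ∧
      ∀ j, Function.Injective (g.ϑ j) := by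
  obtain ⟨K, G, hG⟩ := exists_small_generators E
  let Λ := List (Step 𝒰 G)
  refine ⟨{ d : Code G Λ 𝒰 // ∃ A : LocConst 𝒰, A.HasCode d }, fun d => d.2.choose,
    fun A i x => ?_⟩
  obtain ⟨M, m, y, hy, hm, e, he⟩ := A.exists_orbit hG x
  obtain ⟨d, hd⟩ := M.exists_hasCode (G := G) (Λ := Λ) e he
  let D : { d : Code G Λ 𝒰 // ∃ A : LocConst 𝒰, A.HasCode d } := ⟨d, M, hd⟩
  obtain ⟨g, hg⟩ := HasCode.exists_hom hG D.2.choose_spec hd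
  obtain ⟨z, hz⟩ := (hg i).2 y
  exact ⟨D, g ≫ m, z, (congrArg (m.ϑ i) hz).trans hy, fun j => (hm j).comp (hg j).1⟩

variable (𝒰) in
lemma exists_hit : ∃ (K : Type u) (G : K → LocConst 𝒰), FiberFunctors.Hit (fiber 𝒰) G := by
  obtain ⟨K, G, h⟩ := exists_small_hit 𝒰
  exact ⟨K, G, fun A i x => let ⟨k, g, y, hy, _⟩ := h A i x; ⟨k, g, y, hy⟩⟩

instance : IsGrothendieckTopos.{u} (LocConst 𝒰) := by
  obtain ⟨K, G, h⟩ := exists_hit 𝒰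
  exact FiberFunctors.isGrothendieckTopos (jointlyReflectIsomorphisms_fiber 𝒰) h

end LocConst

namespace CoveringTopos

variable (𝒰 : Cover.{u} E)

lemma exists_hit : ∃ (K : Type u) (G : K → CoveringTopos 𝒰),
    FiberFunctors.Hit (fiber 𝒰) G := by
  obtain ⟨K, G, h⟩ := LocConst.exists_small_hit 𝒰
  refine ⟨{ k // isSumOfCoveringProjections 𝒰 (G k) }, fun k => ⟨G k, k.2⟩, fun A i x => ?_⟩
  obtain ⟨k, g, y, hy, hg⟩ := h A.obj i x
  exact ⟨⟨k, LocConst.isSumOfCoveringProjections_of_injective g hg A.property⟩,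
    ObjectProperty.homMk g, y, hy⟩

instance : IsGrothendieckTopos.{u} (CoveringTopos 𝒰) := by
  obtain ⟨K, G, h⟩ := exists_hit 𝒰
  exact FiberFunctors.isGrothendieckTopos (jointlyReflectIsomorphisms_fiber 𝒰) h

end CoveringTopos

end

noncomputable section

/-! ### Families of sets as sets over the index set -/

/-- A family of sets as a set over the index set. -/
def sigmaOver (I : Type u) : (∀ _ : I, Type u) ⥤ Over I where
  obj S := Over.mk (Y := Σ i, S i) (↾Sigma.fst)
  map g := Over.homMk (↾fun x => ⟨x.1, g x.1 x.2⟩)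

instance (I : Type u) : (sigmaOver I).Faithful where
  map_injective {S T} f g h := funext fun i => ConcreteCategory.hom_ext _ _ fun x => by
    have := ConcreteCategory.congr_hom (congrArg CommaMorphism.left h) ⟨i, x⟩
    exact eq_of_heq (Sigma.mk.inj this).2

instance (I : Type u) : (sigmaOver I).Full where
  map_surjective {S T} g := by
    have hg : ∀ i (x : S i), ∃ y : T i, g.left (⟨i, x⟩ : Σ i, S i) = (⟨i, y⟩ : Σ i, T i) := by
      intro i x
      have h' := ConcreteCategory.congr_hom (Over.w g) (⟨i, x⟩ : Σ i, S i)
      have h : (g.left (⟨i, x⟩ : Σ i, S i) : Σ i, T i).1 = i := h'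
      generalize (g.left (⟨i, x⟩ : Σ i, S i) : Σ i, T i) = z at h
      obtain ⟨j, y⟩ := z
      obtain rfl : j = i := h
      exact ⟨y, rfl⟩
    choose f hf using hg
    refine ⟨fun i => ↾f i, ?_⟩
    apply Over.OverMorphism.ext
    exact ConcreteCategory.hom_ext _ _ fun x => (hf x.1 x.2).symm

instance (I : Type u) : (sigmaOver I).EssSurj where
  mem_essImage Y := ⟨fun i => { y : Y.left // Y.hom y = i }, ⟨Over.isoMk
    (Equiv.sigmaFiberEquiv (fun y : Y.left => Y.hom y)).toIso
      (ConcreteCategory.hom_ext _ _ fun x => x.2.2)⟩⟩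

instance (I : Type u) : (sigmaOver I).IsEquivalence where

section Pi

variable {T : Type v} [Category.{u} T] {I : Type u} (F : I → T ⥤ Type u)

lemma preservesLimitsOfShape_pi' (J : Type*) [Category* J]
    [∀ i, PreservesLimitsOfShape J (F i)] : PreservesLimitsOfShape J (Functor.pi' F) where
  preservesLimit {_} := ⟨fun {_} hc => ⟨
    { lift := fun s i => (isLimitOfPreserves (F i) hc).lift
        { pt := s.pt i
          π := { app := fun j => s.π.app j i
                 naturality := fun _ _ f => congrFun (s.π.naturality f) i } }
      fac := fun _ j => funext fun i => (isLimitOfPreserves (F i) hc).fac _ j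
      uniq := fun s m h => funext fun i => (isLimitOfPreserves (F i) hc).uniq
        { pt := s.pt i
          π := { app := fun j => s.π.app j i
                 naturality := fun _ _ f => congrFun (s.π.naturality f) i } } (m i)
        fun j => congrFun (h j) i }⟩⟩

lemma preservesColimitsOfShape_pi' (J : Type*) [Category* J]
    [∀ i, PreservesColimitsOfShape J (F i)] : PreservesColimitsOfShape J (Functor.pi' F) where
  preservesColimit {_} := ⟨fun {_} hc => ⟨
    { desc := fun s i => (isColimitOfPreserves (F i) hc).desc
        { pt := s.pt i
          ι := { app := fun j => s.ι.app j i
                 naturality := fun _ _ f => congrFun (s.ι.naturality f) i } }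
      fac := fun s j => funext fun i => (isColimitOfPreserves (F i) hc).fac
        { pt := s.pt i
          ι := { app := fun j => s.ι.app j i
                 naturality := fun _ _ f => congrFun (s.ι.naturality f) i } } j
      uniq := fun s m h => funext fun i => (isColimitOfPreserves (F i) hc).uniq
        { pt := s.pt i
          ι := { app := fun j => s.ι.app j i
                 naturality := fun _ _ f => congrFun (s.ι.naturality f) i } } (m i)
        fun j => congrFun (h j) i }⟩⟩

end Pi

variable {E : Type v} [Category.{u} E] [IsGrothendieckTopos.{u} E] (𝒰 : Cover.{u} E)

namespace CoveringTopos

/-! ### The point of the topos of sums of covering projections -/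

/-- The inverse image of the point, through families of sets. -/
def piCompSigmaOverIso : Functor.pi' (fiber 𝒰) ⋙ sigmaOver 𝒰.I ≅ incl 𝒰 ⋙ LocConst.toFamily 𝒰 :=
  Iso.refl _

instance : PreservesFiniteLimits (incl 𝒰 ⋙ LocConst.toFamily 𝒰) := by
  have : PreservesFiniteLimits (Functor.pi' (fiber 𝒰)) :=
    ⟨fun J _ _ => preservesLimitsOfShape_pi' (fiber 𝒰) J⟩
  have : PreservesFiniteLimits (sigmaOver 𝒰.I) := ⟨fun J _ _ => inferInstance⟩
  have := comp_preservesFiniteLimits (Functor.pi' (fiber 𝒰)) (sigmaOver 𝒰.I)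
  exact preservesFiniteLimits_of_natIso (piCompSigmaOverIso 𝒰)

instance : PreservesColimitsOfSize.{u, u} (incl 𝒰 ⋙ LocConst.toFamily 𝒰) := by
  have : PreservesColimitsOfSize.{u, u} (Functor.pi' (fiber 𝒰)) :=
    ⟨fun {J} _ => preservesColimitsOfShape_pi' (fiber 𝒰) J⟩
  exact preservesColimits_of_natIso (piCompSigmaOverIso 𝒰)

instance : (incl 𝒰 ⋙ LocConst.toFamily 𝒰).Faithful where
  map_injective {A B} f g h := by
    apply ObjectProperty.hom_ext
    refine LocConst.hom_ext_fiber fun i => ConcreteCategory.hom_ext _ _ fun x => ?_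
    have := ConcreteCategory.congr_hom (congrArg CommaMorphism.left h) (⟨i, x⟩ : Σ i, A.obj.S i)
    exact eq_of_heq (Sigma.mk.inj this).2

/-- Cocontinuous functors from the topos of sums of covering projections are left adjoints. -/
lemma isLeftAdjoint {D : Type*} [Category.{u} D] (H : CoveringTopos 𝒰 ⥤ D)
    [PreservesColimitsOfSize.{u, u} H] : H.IsLeftAdjoint := by
  obtain ⟨K, G, h⟩ := exists_hit 𝒰
  exact FiberFunctors.isLeftAdjoint (jointlyReflectIsomorphisms_fiber 𝒰) h H

/-- A cocontinuous left exact functor is the inverse image of a geometric morphism. -/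
lemma exists_geometricMorphism {D : Type w} [Category.{u} D] (H : CoveringTopos 𝒰 ⥤ D)
    [PreservesColimitsOfSize.{u, u} H] [PreservesFiniteLimits H] :
    ∃ μ : GeometricMorphism D (CoveringTopos 𝒰), μ.inverseImage = H := by
  have := isLeftAdjoint 𝒰 H
  exact ⟨⟨H, H.rightAdjoint, Adjunction.ofIsLeftAdjoint H, inferInstance⟩, rfl⟩

/-! ### Connectedness -/

/-- The functor which sends a sum of covering projections to its total object. -/
abbrev total : CoveringTopos 𝒰 ⥤ E := incl 𝒰 ⋙ LocConst.total 𝒰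

instance : (total 𝒰).Faithful where
  map_injective h := ObjectProperty.hom_ext _ (LocConst.hom_ext_total h)

/-- The total object of the terminal object is terminal. -/
def isTerminalTotal : IsTerminal ((total 𝒰).obj (⊤_ (CoveringTopos 𝒰))) := by
  have := constInv_preservesFiniteLimits E
  have h₁ : IsTerminal ((incl 𝒰).obj (⊤_ (CoveringTopos 𝒰))) :=
    IsTerminal.isTerminalObj (incl 𝒰) _ terminalIsTerminal
  have h₂ : IsTerminal ((constInv E).obj PUnit.{u + 1}) :=
    IsTerminal.isTerminalObj (constInv E) _ Types.isTerminalPUnit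
  exact h₂.ofIso ((LocConst.total 𝒰).mapIso
    ((LocConst.constPUnitIsTerminal 𝒰).uniqueUpToIso h₁))

/-- The comparison between constant objects. -/
def constTotal (P : Type u) :
    (constInv E).obj P ⟶ (total 𝒰).obj ((constInv (CoveringTopos 𝒰)).obj P) :=
  Limits.Sigma.map (fun _ : P => (isTerminalTotal 𝒰).from (⊤_ E)) ≫
    sigmaComparison (total 𝒰) (fun _ : P => ⊤_ (CoveringTopos 𝒰))

instance (P : Type u) : IsIso (constTotal 𝒰 P) := by
  have : IsIso ((isTerminalTotal 𝒰).from (⊤_ E)) :=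
    (terminalIsTerminal.uniqueUpToIso (isTerminalTotal 𝒰)).isIso_hom
  exact IsIso.comp_isIso' (Sigma.mapIso fun _ : P => asIso ((isTerminalTotal 𝒰).from (⊤_ E))).isIso_hom
    (inferInstanceAs (IsIso (sigmaComparison (total 𝒰) (fun _ : P => ⊤_ (CoveringTopos 𝒰)))))

lemma constPt_constTotal {P : Type u} (x : P) : constPt x ≫ constTotal 𝒰 P =
    (isTerminalTotal 𝒰).from (⊤_ E) ≫ (total 𝒰).map (constPt x) := by
  have h : constPt x ≫ Limits.Sigma.map (fun _ : P => (isTerminalTotal 𝒰).from (⊤_ E)) =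
      (isTerminalTotal 𝒰).from (⊤_ E) ≫ Sigma.ι (fun _ : P => (total 𝒰).obj (⊤_ _)) x :=
    Sigma.ι_map _ _
  exact (Category.assoc _ _ _).symm.trans ((congrArg (· ≫ sigmaComparison (total 𝒰) _) h).trans
    ((Category.assoc _ _ _).trans (congrArg (_ ≫ ·) (ι_comp_sigmaComparison (total 𝒰) _ x))))

/-- The functor to the base topos commutes with the constant object functors. -/
def constTotalIso : constInv E ≅ constInv (CoveringTopos 𝒰) ⋙ total 𝒰 :=
  NatIso.ofComponents (fun P => asIso (constTotal 𝒰 P)) fun {P Q} f => by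
    refine const_hom_ext fun x => ?_
    calc _ = (constPt x ≫ (constInv E).map f) ≫ constTotal 𝒰 Q := (Category.assoc _ _ _).symm
      _ = (isTerminalTotal 𝒰).from (⊤_ E) ≫ (total 𝒰).map (constPt (f x)) := by
        rw [constPt_map, constPt_constTotal]
      _ = (isTerminalTotal 𝒰).from (⊤_ E) ≫ (total 𝒰).map (constPt x) ≫
          (total 𝒰).map ((constInv (CoveringTopos 𝒰)).map f) := by
        rw [← constPt_map, Functor.map_comp]
      _ = (constPt x ≫ constTotal 𝒰 P) ≫
          (total 𝒰).map ((constInv (CoveringTopos 𝒰)).map f) := by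
        rw [constPt_constTotal, Category.assoc]
      _ = _ := Category.assoc _ _ _

theorem isConnectedTopos (h : IsConnectedTopos E) : IsConnectedTopos (CoveringTopos 𝒰) := by
  obtain ⟨h₁, h₂⟩ := h
  have : (constInv E).Full := h₁
  have : (constInv E).Faithful := h₂
  have : (constInv (CoveringTopos 𝒰) ⋙ total 𝒰).Full := Functor.Full.of_iso (constTotalIso 𝒰)
  have : (constInv (CoveringTopos 𝒰) ⋙ total 𝒰).Faithful :=
    Functor.Faithful.of_iso (constTotalIso 𝒰)
  exact ⟨Functor.Full.of_comp_faithful (constInv (CoveringTopos 𝒰)) (total 𝒰),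
    Functor.Faithful.of_comp (constInv (CoveringTopos 𝒰)) (total 𝒰)⟩

end CoveringTopos

end

theorem mainTheorem4 {E : Type v} [Category.{u} E] [IsGrothendieckTopos.{u} E]
    (𝒰 : Cover.{u} E) :
    IsGrothendieckTopos.{u} (LocConst 𝒰) ∧
    (∃ _ : IsGrothendieckTopos.{u} (CoveringTopos 𝒰),
      IsAtomicTopos (CoveringTopos 𝒰) ∧
      IsLocallyConnectedTopos (CoveringTopos 𝒰) ∧
      IsBooleanTopos (CoveringTopos 𝒰) ∧
      (IsConnectedTopos E → IsConnectedTopos (CoveringTopos 𝒰))) ∧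
    (∃ μ : GeometricMorphism (LocConst 𝒰) (CoveringTopos 𝒰),
      μ.inverseImage = CoveringTopos.incl 𝒰) ∧
    (∃ ρ : GeometricMorphism (Over 𝒰.I) (CoveringTopos 𝒰),
      ρ.inverseImage = CoveringTopos.incl 𝒰 ⋙ LocConst.toFamily 𝒰 ∧ ρ.IsSurjective) := by
  refine ⟨inferInstance, ⟨inferInstance, ?_, ?_, ?_, ?_⟩, ?_, ?_⟩
  · exact (CoveringTopos.orbitRelation 𝒰).isAtomicTopos
      (CoveringTopos.jointlyReflectIsomorphisms_fiber 𝒰)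
  · exact (CoveringTopos.orbitRelation 𝒰).isLocallyConnectedTopos
      (CoveringTopos.jointlyReflectIsomorphisms_fiber 𝒰)
  · exact (CoveringTopos.orbitRelation 𝒰).isBooleanTopos
      (CoveringTopos.jointlyReflectIsomorphisms_fiber 𝒰)
  · exact CoveringTopos.isConnectedTopos 𝒰
  · exact CoveringTopos.exists_geometricMorphism 𝒰 (CoveringTopos.incl 𝒰)
  · obtain ⟨ρ, hρ⟩ := CoveringTopos.exists_geometricMorphism 𝒰
      (CoveringTopos.incl 𝒰 ⋙ LocConst.toFamily 𝒰)
    refine ⟨ρ, hρ, ?_⟩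
    rw [GeometricMorphism.IsSurjective, hρ]
    infer_instance
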